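/- Let $X\subseteq\mathbb{R}^n$ be closed and convex, let $f:\mathbb{R}^n\to\mathbb{R}$ be differentiable with Lipschitz continuous gradient, and let $\beta>0$ and $\sigma\ge 0$. Given $a>0$, the averaged stochastic approximation (ASA) method starts from random vectors $x^0\in X$ and $z^0\in\mathbb{R}^n$ and, for $k=0,1,2,\dots$, computes $$y^k=\operatorname*{argmin}_{y\in X}\Big\{\langle z^k,y-x^k\rangle+\tfrac{\beta}{2}\|y-x^k\|^2\Big\},\qquad x^{k+1}=x^k+\tau_k(y^k-x^k),\qquad z^{k+1}=(1-a\tau_k)z^k+a\tau_k s^{k+1}.$$ Here $\mathcal{F}_k$ is the $\sigma$-algebra generated by $x^0,\dots,x^k,z^0,\dots,z^k$, the stepsize $\tau_k\in(0,1/a]$ is $\mathcal{F}_k$-measurable, and the random vectors $s^{k+1}$ satisfy, almost surely for every $k\ge 0$, $$\mathbb{E}[s^{k+1}\mid\mathcal{F}_k]=\nabla f(x^k),\qquad \mathbb{E}\big[\|s^{k+1}-\nabla f(x^k)\|^2\mid\mathcal{F}_k\big]\le\sigma^2 .$$ Then there is a constant $\bar a>0$ (depending only on $n$, $X$, $f$,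 $\beta$, $\sigma$) such that, for every $a\in(0,\bar a)$ and all sequences generated in this way on any probability space with $$\sum_{k=1}^\infty\tau_k=+\infty\ \text{ a.s.},\qquad \mathbb{E}\sum_{k=1}^\infty\tau_k^2<\infty,$$ with probability 1 every accumulation point $(x^*,z^*)$ of the sequence $\{(x^k,z^k)\}_{k\ge 0}$ satisfies $$z^*=\nabla f(x^*),\qquad -z^*\in\mathcal{N}_X(x^*),$$ where $\mathcal{N}_X(x)=\{v\in\mathbb{R}^n:\langle v,y-x\rangle\le 0\ \text{for all } y\in X\}$ for $x\in X$ is the normal cone to $X$ at $x$ (in particular, $x^*\in X$). -/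

import Mathlib

open MeasureTheory Filter Topology
open scoped InnerProductSpace NNReal ENNReal

namespace ASA

/-- The normal cone (of convex analysis) to `X` at `x`; it is empty when `x ∉ X`. -/
def normalCone {n : ℕ} (X : Set (EuclideanSpace ℝ (Fin n))) (x : EuclideanSpace ℝ (Fin n)) :
    Set (EuclideanSpace ℝ (Fin n)) :=
  {v | x ∈ X ∧ ∀ y ∈ X, ⟪v, y - x⟫_ℝ ≤ 0}

/-- The objective `y ↦ ⟨z, y - x⟩ + (β / 2) ‖y - x‖²` of the direction-finding subproblem. -/
noncomputable def subproblem {n : ℕ} (β : ℝ) (x z y : EuclideanSpace ℝ (Fin n)) : ℝ :=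
  ⟪z, y - x⟫_ℝ + β / 2 * ‖y - x‖ ^ 2

/-- The σ-algebra `ℱ_k` generated by `x⁰, …, xᵏ, z⁰, …, zᵏ`. -/
abbrev history {n : ℕ} {Ω : Type*} (x z : ℕ → Ω → EuclideanSpace ℝ (Fin n)) (k : ℕ) :
    MeasurableSpace Ω :=
  ⨆ i ∈ Set.Iic k,
    (MeasurableSpace.comap (x i) inferInstance ⊔ MeasurableSpace.comap (z i) inferInstance)

/-- `(x, y, z)` are random sequences generated by the averaged stochastic approximation method
on the closed convex set `X`, with averaging parameter `a`, constant regularization coefficient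
`β`, stepsizes `τ` and oracle answers `s`. -/
structure IsASASequence {n : ℕ} {Ω : Type*} [MeasurableSpace Ω]
    (X : Set (EuclideanSpace ℝ (Fin n))) (a β : ℝ)
    (τ : ℕ → Ω → ℝ) (s x y z : ℕ → Ω → EuclideanSpace ℝ (Fin n)) : Prop where
  measurable_x : ∀ k, Measurable (x k)
  measurable_z : ∀ k, Measurable (z k)
  measurable_s : ∀ k, Measurable (s (k + 1))
  /-- the stepsizes may be random, but depend on the history only -/
  measurable_τ : ∀ k, Measurable[history x z k] (τ k)
  τ_pos : ∀ k ω, 0 < τ k ω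
  τ_le : ∀ k ω, τ k ω ≤ 1 / a
  x_zero_mem : ∀ ω, x 0 ω ∈ X
  /-- `yᵏ` solves the subproblem over `X` at `(xᵏ, zᵏ)` -/
  y_mem : ∀ k ω, y k ω ∈ X
  y_min : ∀ k ω, IsMinOn (subproblem β (x k ω) (z k ω)) X (y k ω)
  x_succ : ∀ k ω, x (k + 1) ω = x k ω + τ k ω • (y k ω - x k ω)
  z_succ : ∀ k ω, z (k + 1) ω = (1 - a * τ k ω) • z k ω + (a * τ k ω) • s (k + 1) ω

/-- The stochastic oracle is conditionally unbiased, with conditional variance at most `σ²`: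
`𝔼[sᵏ⁺¹ | ℱ_k] = ∇f(xᵏ)` and `𝔼[‖sᵏ⁺¹ - ∇f(xᵏ)‖² | ℱ_k] ≤ σ²` almost surely. -/
structure IsOracle {n : ℕ} {Ω : Type*} [MeasurableSpace Ω] (μ : Measure Ω)
    (f : EuclideanSpace ℝ (Fin n) → ℝ) (σ : ℝ)
    (s x z : ℕ → Ω → EuclideanSpace ℝ (Fin n)) : Prop where
  integrable : ∀ k, Integrable (s (k + 1)) μ
  unbiased : ∀ k, μ[s (k + 1) | history x z k] =ᵐ[μ] fun ω => gradient f (x k ω)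
  integrable_sq : ∀ k, Integrable (fun ω => ‖s (k + 1) ω - gradient f (x k ω)‖ ^ 2) μ
  variance_le : ∀ k,
    μ[fun ω => ‖s (k + 1) ω - gradient f (x k ω)‖ ^ 2 | history x z k] ≤ᵐ[μ] fun _ => σ ^ 2

end ASA

/-!
The merit function `W(x, z) = a f(x) - η(x, z) + c ‖∇f(x) - z‖²`, where `η(x, z)` is the optimal
value of the direction-finding subproblem, decreases along the method. With `y` the solution of the
subproblem, one step changes `W` by at most `-κ τ D`, where `D = ‖y - x‖² + ‖∇f(x) - z‖²`, up to
terms of order `τ²` and a noise term `τ ⟪v, e⟫` that is linear in the oracle error `e`, with `v`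
predictable and `‖v‖² = O(D)` (`exists_merit_step_le`).

Neither `f` nor the iterates are assumed bounded, and the initial point need not be integrable, so
supermartingale convergence does not apply to `W`. Instead, the noise terms are shown to be almost
surely `o(∑ τ² ‖v‖²) + O(1)` (`IsNoise.ae_abs_sum_inner_le`): after division by
`1 + ∑ i ≤ j, τ i² ‖v i‖²` they form a martingale bounded in `L²`, and Kronecker's lemma undoes the
division. Since `τ → 0`, the noise is then dominated by the decrease, and either `W → -∞` or
`∑ τ D < ∞` (`summable_of_descent`). The first case excludes cluster points because `W` is
continuous. In the second case, `∑ τ = ∞` forces `D = 0` at each cluster point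
(`nonpos_of_mapClusterPt`): otherwise the path would be trapped where `D` is bounded below, as the
length of its excursions is controlled by `∑ τ D`. Finally `D(x, z) = 0` says that `z = ∇f(x)` and
that `x` solves its own subproblem, which is the optimality condition.

As `τ ≤ 1 / a` allows `τ > 1`, the iterates may leave `X`, where `W` need not decrease. The argument
is therefore run on a companion sequence `x̃ ∈ X`, with steps `min τ 1`, and on
`z̃ = z - β (x - x̃)`, for which `y` solves the subproblem as well. From the time when all stepsizes
are at most `1`, the pair `(x̃, z̃)` follows the method with an oracle bias of order `‖x - x̃‖`, and
`‖x - x̃‖` is multiplied by `1 - τ` at each step: it tends to `0`, and the bias is summable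
against `τ`. This works for every `a > 0`.
-/

namespace ASA

/-! ### Stochastic series driven by a martingale difference noise -/

/-- `e k` is the noise revealed between the times `k` and `k + 1`: given `ℱ k` it has mean zero and
second moment at most `σ ^ 2`. -/
structure IsNoise {Ω E : Type*} [NormedAddCommGroup E] [InnerProductSpace ℝ E] [CompleteSpace E]
    {m0 : MeasurableSpace Ω} (ℱ : Filtration ℕ m0) (μ : Measure Ω) (σ : ℝ) (e : ℕ → Ω → E) :
    Prop where
  stronglyMeasurable : ∀ k, StronglyMeasurable[ℱ (k + 1)] (e k)
  integrable_sq : ∀ k, Integrable (fun ω => ‖e k ω‖ ^ 2) μ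
  condExp_eq_zero : ∀ k, μ[e k | ℱ k] =ᵐ[μ] 0
  condExp_sq_le : ∀ k, μ[fun ω => ‖e k ω‖ ^ 2 | ℱ k] ≤ᵐ[μ] fun _ => σ ^ 2

namespace IsNoise

variable {Ω E : Type*} [NormedAddCommGroup E] [InnerProductSpace ℝ E] [CompleteSpace E]
  {m0 : MeasurableSpace Ω} {ℱ : Filtration ℕ m0} {μ : Measure Ω} {σ : ℝ} {e : ℕ → Ω → E}

lemma memLp (he : IsNoise ℱ μ σ e) (k : ℕ) : MemLp (e k) 2 μ :=
  (memLp_two_iff_integrable_sq_norm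
    ((he.stronglyMeasurable k).mono (ℱ.le _)).aestronglyMeasurable).2 (he.integrable_sq k)

lemma integrable [IsFiniteMeasure μ] (he : IsNoise ℱ μ σ e) (k : ℕ) : Integrable (e k) μ :=
  (he.memLp k).integrable (by norm_num)

lemma integrable_weight_mul_sq (he : IsNoise ℱ μ σ e) {k : ℕ} {w : Ω → ℝ}
    (hw : StronglyMeasurable[ℱ k] w) {B : ℝ} (hB : ∀ ω, |w ω| ≤ B) :
    Integrable (fun ω => w ω * ‖e k ω‖ ^ 2) μ :=
  (he.integrable_sq k).bdd_mul (c := B) (hw.mono (ℱ.le _)).aestronglyMeasurable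
    (Eventually.of_forall hB)

lemma integral_weight_mul_sq_le [IsFiniteMeasure μ] (he : IsNoise ℱ μ σ e) {k : ℕ} {w : Ω → ℝ}
    (hw : StronglyMeasurable[ℱ k] w) (hw0 : ∀ ω, 0 ≤ w ω) {B : ℝ} (hB : ∀ ω, w ω ≤ B) :
    ∫ ω, w ω * ‖e k ω‖ ^ 2 ∂μ ≤ σ ^ 2 * ∫ ω, w ω ∂μ := by
  have hB' : ∀ ω, |w ω| ≤ B := fun ω => by rw [abs_of_nonneg (hw0 ω)]; exact hB ω
  have hi := he.integrable_weight_mul_sq hw hB'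
  have hwi : Integrable w μ := Integrable.of_bound (hw.mono (ℱ.le _)).aestronglyMeasurable B
    (Eventually.of_forall hB')
  have hpull := condExp_mul_of_stronglyMeasurable_left (μ := μ) (m := ℱ k) hw hi
    (he.integrable_sq k)
  rw [← integral_condExp (ℱ.le k), ← integral_const_mul]
  refine integral_mono_ae integrable_condExp (hwi.const_mul _) ?_
  filter_upwards [hpull, he.condExp_sq_le k] with ω h1 h2
  have : (fun ω => w ω * ‖e k ω‖ ^ 2) = w * (fun ω => ‖e k ω‖ ^ 2) := rfl
  rw [this, h1, Pi.mul_apply, mul_comm]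
  exact mul_le_mul_of_nonneg_right h2 (hw0 ω)

lemma summable_weight_mul_sq [IsFiniteMeasure μ] (he : IsNoise ℱ μ σ e) {w : ℕ → Ω → ℝ}
    (hw : ∀ k, StronglyMeasurable[ℱ k] (w k)) (hw0 : ∀ k ω, 0 ≤ w k ω) {B : ℝ}
    (hB : ∀ k ω, w k ω ≤ B) (hsum : Summable fun k => ∫ ω, w k ω ∂μ) :
    ∀ᵐ ω ∂μ, Summable fun k => w k ω * ‖e k ω‖ ^ 2 := by
  have hi : ∀ k, Integrable (fun ω => w k ω * ‖e k ω‖ ^ 2) μ := fun k =>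
    he.integrable_weight_mul_sq (hw k) (B := B)
      (fun ω => by rw [abs_of_nonneg (hw0 k ω)]; exact hB k ω)
  have h0 : ∀ k ω, 0 ≤ w k ω * ‖e k ω‖ ^ 2 := fun k ω => mul_nonneg (hw0 k ω) (sq_nonneg _)
  have hs : Summable fun k => ∫ ω, w k ω * ‖e k ω‖ ^ 2 ∂μ :=
    (hsum.mul_left (σ ^ 2)).of_nonneg_of_le (fun k => integral_nonneg (h0 k))
      fun k => he.integral_weight_mul_sq_le (hw k) (hw0 k) (hB k)
  have hlt : ∫⁻ ω, ∑' k, ENNReal.ofReal (w k ω * ‖e k ω‖ ^ 2) ∂μ ≠ ∞ := by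
    rw [lintegral_tsum fun k => (hi k).1.aemeasurable.ennreal_ofReal]
    have : ∀ k, ∫⁻ ω, ENNReal.ofReal (w k ω * ‖e k ω‖ ^ 2) ∂μ
        = ENNReal.ofReal (∫ ω, w k ω * ‖e k ω‖ ^ 2 ∂μ) := fun k =>
      (ofReal_integral_eq_lintegral_ofReal (hi k) (Eventually.of_forall (h0 k))).symm
    simp_rw [this]
    rw [← ENNReal.ofReal_tsum_of_nonneg (fun k => integral_nonneg (h0 k)) hs]
    exact ENNReal.ofReal_ne_top
  filter_upwards [ae_lt_top' (AEMeasurable.tsum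
    fun k => (hi k).1.aemeasurable.ennreal_ofReal) hlt] with ω hω
  have := ENNReal.summable_toReal hω.ne
  refine this.congr fun k => ?_
  rw [ENNReal.toReal_ofReal (h0 k ω)]

/-- Transforms of the noise by predictable square summable weights converge almost surely: they are
martingales bounded in `L²`. -/
lemma ae_exists_tendsto_sum_inner [IsProbabilityMeasure μ] (he : IsNoise ℱ μ σ e) {w : ℕ → Ω → E}
    (hw : ∀ k, StronglyMeasurable[ℱ k] (w k)) {B : ℝ}
    (hB : ∀ k ω, ‖w k ω‖ ≤ B) (hsum : Summable fun k => ∫ ω, ‖w k ω‖ ^ 2 ∂μ) :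
    ∀ᵐ ω ∂μ, ∃ c, Tendsto (fun k => ∑ j ∈ Finset.range k, ⟪w j ω, e j ω⟫_ℝ) atTop (𝓝 c) := by
  set S : ℕ → Ω → ℝ := fun k ω => ∑ j ∈ Finset.range k, ⟪w j ω, e j ω⟫_ℝ with hS
  have hem : ∀ k, AEStronglyMeasurable (e k) μ := fun k => (he.memLp k).1
  have hwm : ∀ k, AEStronglyMeasurable (w k) μ := fun k =>
    ((hw k).mono (ℱ.le _)).aestronglyMeasurable
  have hmL : ∀ k, MemLp (fun ω => ⟪w k ω, e k ω⟫_ℝ) 2 μ := fun k =>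
    (he.memLp k).of_le_mul (c := B) ((hwm k).inner (hem k)) (Eventually.of_forall fun ω =>
      (norm_inner_le_norm _ _).trans (mul_le_mul_of_nonneg_right (hB k ω) (norm_nonneg _)))
  have hsq : ∀ k, ∫ ω, ⟪w k ω, e k ω⟫_ℝ ^ 2 ∂μ ≤ σ ^ 2 * ∫ ω, ‖w k ω‖ ^ 2 ∂μ := by
    intro k
    have hB2 : ∀ ω, ‖w k ω‖ ^ 2 ≤ B ^ 2 := fun ω => pow_le_pow_left₀ (norm_nonneg _) (hB k ω) 2
    refine le_trans (integral_mono (hmL k).integrable_sq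
      (he.integrable_weight_mul_sq (w := fun ω => ‖w k ω‖ ^ 2) (B := B ^ 2) ((hw k).norm.pow 2)
        (fun ω => by rw [abs_of_nonneg (sq_nonneg _)]; exact hB2 ω)) fun ω => ?_)
      (he.integral_weight_mul_sq_le ((hw k).norm.pow 2) (fun ω => sq_nonneg _) hB2)
    rw [← mul_pow, ← sq_abs]
    exact pow_le_pow_left₀ (abs_nonneg _) (abs_real_inner_le_norm _ _) 2
  have hSL : ∀ k, MemLp (S k) 2 μ := fun k => memLp_finsetSum _ fun j _ => hmL j
  have hSm : ∀ k, StronglyMeasurable[ℱ k] (S k) := fun k =>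
    Finset.stronglyMeasurable_fun_sum _ fun j hj => by
      have hj' : j + 1 ≤ k := Finset.mem_range.1 hj
      exact (((hw j).mono (ℱ.mono (by omega))).inner
        ((he.stronglyMeasurable j).mono (ℱ.mono hj')))
  have hcond : ∀ k (v : Ω → E), StronglyMeasurable[ℱ k] v → Integrable (fun ω => ⟪v ω, e k ω⟫_ℝ) μ →
      μ[fun ω => ⟪v ω, e k ω⟫_ℝ | ℱ k] =ᵐ[μ] 0 := by
    intro k v hv hi
    have : μ[fun ω => ⟪v ω, e k ω⟫_ℝ | ℱ k] =ᵐ[μ] fun ω => ⟪v ω, (μ[e k | ℱ k]) ω⟫_ℝ :=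
      condExp_bilin_of_stronglyMeasurable_left (innerSL ℝ) hv hi (he.integrable k)
    filter_upwards [this, he.condExp_eq_zero k] with ω h1 h2
    rw [h1, h2]; simp
  have hstep : ∀ k, ∫ ω, S (k + 1) ω ^ 2 ∂μ
      = ∫ ω, S k ω ^ 2 ∂μ + ∫ ω, ⟪w k ω, e k ω⟫_ℝ ^ 2 ∂μ := by
    intro k
    have hcross : Integrable (fun ω => S k ω * ⟪w k ω, e k ω⟫_ℝ) μ := (hSL k).integrable_mul (hmL k)
    have hz : ∫ ω, S k ω * ⟪w k ω, e k ω⟫_ℝ ∂μ = 0 := by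
      have := hcond k (fun ω => S k ω • w k ω) ((hSm k).smul (hw k))
        (by simpa [real_inner_smul_left] using hcross)
      simp only [real_inner_smul_left] at this
      rw [← integral_condExp (ℱ.le k), integral_congr_ae this]; simp
    have : ∀ ω, S (k + 1) ω ^ 2
        = S k ω ^ 2 + 2 * (S k ω * ⟪w k ω, e k ω⟫_ℝ) + ⟪w k ω, e k ω⟫_ℝ ^ 2 := fun ω => by
      simp only [hS, Finset.sum_range_succ]; ring
    simp_rw [this]
    have hi : Integrable (fun ω => S k ω ^ 2 + 2 * (S k ω * ⟪w k ω, e k ω⟫_ℝ)) μ :=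
      (hSL k).integrable_sq.add (hcross.const_mul 2)
    rw [integral_add hi (hmL k).integrable_sq,
      integral_add (hSL k).integrable_sq (hcross.const_mul 2), integral_const_mul, hz]
    ring
  have hbound : ∀ k, ∫ ω, S k ω ^ 2 ∂μ ≤ σ ^ 2 * ∑' j, ∫ ω, ‖w j ω‖ ^ 2 ∂μ := by
    intro k
    have h1 : ∫ ω, S k ω ^ 2 ∂μ ≤ σ ^ 2 * ∑ j ∈ Finset.range k, ∫ ω, ‖w j ω‖ ^ 2 ∂μ := by
      induction k with
      | zero => simp [hS]
      | succ k ih => rw [hstep, Finset.sum_range_succ, mul_add]; exact add_le_add ih (hsq k)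
    exact h1.trans (mul_le_mul_of_nonneg_left
      (hsum.sum_le_tsum _ fun j _ => integral_nonneg fun ω => sq_nonneg _) (sq_nonneg _))
  have hmart : Martingale S ℱ μ := by
    refine martingale_of_condExp_sub_eq_zero_nat hSm
      (fun k => (hSL k).integrable (by norm_num)) fun k => ?_
    have : S (k + 1) - S k = fun ω => ⟪w k ω, e k ω⟫_ℝ := by
      ext ω; simp [hS, Finset.sum_range_succ]
    rw [this]
    exact hcond k (w k) (hw k) ((hmL k).integrable (by norm_num))
  refine hmart.submartingale.exists_ae_tendsto_of_bdd
    (R := (1 + σ ^ 2 * ∑' j, ∫ ω, ‖w j ω‖ ^ 2 ∂μ).toNNReal) fun k => ?_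
  rw [eLpNorm_one_eq_lintegral_enorm, ← ofReal_integral_norm_eq_lintegral_enorm
    ((hSL k).integrable (by norm_num))]
  refine ENNReal.ofReal_le_ofReal ?_
  have h1 : ∫ ω, ‖S k ω‖ ∂μ ≤ ∫ ω, (1 + S k ω ^ 2) ∂μ :=
    integral_mono ((hSL k).integrable (by norm_num)).norm
      ((integrable_const _).add (hSL k).integrable_sq) fun ω => by
        simp only [Real.norm_eq_abs]
        nlinarith [sq_abs (S k ω), sq_nonneg (|S k ω| - 1)]
  rw [integral_add (integrable_const _) (hSL k).integrable_sq] at h1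
  simp only [integral_const, probReal_univ, smul_eq_mul, mul_one] at h1
  linarith [hbound k]

end IsNoise

/-! ### A strong law through Kronecker's lemma -/

/-- Quantitative Kronecker lemma: if `∑ m j / (1 + A (j + 1))` converges, where `A` is nondecreasing
and nonnegative, then the partial sums of `m` are `o(A) + O(1)`. -/
lemma eventually_abs_sum_le_of_tendsto {A m : ℕ → ℝ} (hA : Monotone A) (hA0 : A 0 = 0) {c : ℝ}
    (h : Tendsto (fun k => ∑ j ∈ Finset.range k, m j / (1 + A (j + 1))) atTop (𝓝 c))
    {ε : ℝ} (hε : 0 < ε) :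
    ∃ C, ∀ᶠ k in atTop, |∑ j ∈ Finset.range k, m j| ≤ ε * A k + C := by
  have hpos : ∀ j, 0 < 1 + A j := fun j => by linarith [hA (Nat.zero_le j)]
  set U : ℕ → ℝ := fun k => ∑ j ∈ Finset.range k, m j / (1 + A (j + 1)) - c with hU
  set N : ℕ → ℝ := fun k => ∑ j ∈ Finset.range k, m j with hN
  have hU0 : ∀ᶠ k in atTop, |U k| ≤ ε / 2 := by
    have : Tendsto (fun k => |U k|) atTop (𝓝 0) := by
      simpa using (h.sub_const c).abs
    exact this.eventually_le_const (by linarith)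
  obtain ⟨J, hJ⟩ := eventually_atTop.1 hU0
  have key : ∀ k, J ≤ k → |N k - (1 + A k) * U k|
      ≤ |N J - (1 + A J) * U J| + ε / 2 * (A k - A J) := by
    intro k hk
    induction k, hk using Nat.le_induction with
    | base => simp
    | succ k hk ih =>
      -- summation by parts: only the increment of `A` against `U k` survives
      have : N (k + 1) - (1 + A (k + 1)) * U (k + 1)
          = (N k - (1 + A k) * U k) - (A (k + 1) - A k) * U k := by
        have := (hpos (k + 1)).ne'
        simp only [hN, hU, Finset.sum_range_succ]
        field_simp
        ring
      rw [this]
      refine (abs_sub _ _).trans ?_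
      rw [abs_mul, abs_of_nonneg (sub_nonneg.2 (hA (Nat.le_succ k)))]
      have := mul_le_mul_of_nonneg_left (hJ k hk) (sub_nonneg.2 (hA (Nat.le_succ k)))
      linarith
  refine ⟨|N J - (1 + A J) * U J| + ε / 2, eventually_atTop.2 ⟨J, fun k hk => ?_⟩⟩
  have h1 := key k hk
  have h2 : |(1 + A k) * U k| ≤ (1 + A k) * (ε / 2) := by
    rw [abs_mul, abs_of_pos (hpos k)]
    exact mul_le_mul_of_nonneg_left (hJ k hk) (hpos k).le
  have h3 : |N k| ≤ |N k - (1 + A k) * U k| + |(1 + A k) * U k| := by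
    simpa using abs_add_le (N k - (1 + A k) * U k) ((1 + A k) * U k)
  have h4 : 0 ≤ ε / 2 * A J := mul_nonneg (by linarith) (hA0 ▸ hA (Nat.zero_le J))
  linarith

/-- Strong law for noise transforms: `∑ ⟪v j, e j⟫` is negligible with respect to `∑ ‖v j‖ ^ 2`,
up to a bounded error, whatever the predictable process `v`. No integrability of `v` is needed,
since dividing the increments by `1 + ∑ i ≤ j, ‖v i‖ ^ 2` makes them summable in `L²`. -/
lemma IsNoise.ae_abs_sum_inner_le {Ω E : Type*} [NormedAddCommGroup E] [InnerProductSpace ℝ E]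
    [CompleteSpace E] {m0 : MeasurableSpace Ω} {ℱ : Filtration ℕ m0} {μ : Measure Ω}
    [IsProbabilityMeasure μ] {σ : ℝ} {e : ℕ → Ω → E} (he : IsNoise ℱ μ σ e) {v : ℕ → Ω → E}
    (hv : ∀ k, StronglyMeasurable[ℱ k] (v k)) :
    ∀ᵐ ω ∂μ, ∀ ε > 0, ∃ C, ∀ᶠ k in atTop, |∑ j ∈ Finset.range k, ⟪v j ω, e j ω⟫_ℝ|
      ≤ ε * ∑ j ∈ Finset.range k, ‖v j ω‖ ^ 2 + C := by
  set A : ℕ → Ω → ℝ := fun k ω => ∑ j ∈ Finset.range k, ‖v j ω‖ ^ 2 with hA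
  have hA0 : ∀ k ω, 0 ≤ A k ω := fun k ω => Finset.sum_nonneg fun j _ => sq_nonneg _
  have hAs : ∀ k ω, A (k + 1) ω = A k ω + ‖v k ω‖ ^ 2 := fun k ω => Finset.sum_range_succ _ _
  have hAm : ∀ k, StronglyMeasurable[ℱ k] (A (k + 1)) := fun k =>
    Finset.stronglyMeasurable_fun_sum _ fun j hj => by
      have hj' : j ≤ k := Nat.lt_succ_iff.1 (Finset.mem_range.1 hj)
      exact ((hv j).mono (ℱ.mono hj')).norm.pow 2
  set w : ℕ → Ω → E := fun k ω => (1 + A (k + 1) ω)⁻¹ • v k ω with hw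
  have hwm : ∀ k, StronglyMeasurable[ℱ k] (w k) := fun k =>
    StronglyMeasurable.smul (StronglyMeasurable.inv₀ (stronglyMeasurable_const.add (hAm k))) (hv k)
  have hwsq : ∀ k ω, ‖w k ω‖ ^ 2 ≤ (1 + A k ω)⁻¹ - (1 + A (k + 1) ω)⁻¹ := by
    intro k ω
    have h1 : 0 < 1 + A k ω := by linarith [hA0 k ω]
    have h2 : 0 < 1 + A (k + 1) ω := by linarith [hA0 (k + 1) ω]
    have h3 : A (k + 1) ω - A k ω = ‖v k ω‖ ^ 2 := by rw [hAs]; ring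
    rw [hw, norm_smul, mul_pow, norm_inv, Real.norm_of_nonneg h2.le, ← h3,
      inv_sub_inv h1.ne' h2.ne', inv_pow, inv_mul_eq_div]
    have h4 : 0 ≤ A (k + 1) ω - A k ω := h3 ▸ sq_nonneg _
    have h5 : (1 + A (k + 1) ω - (1 + A k ω)) = A (k + 1) ω - A k ω := by ring
    rw [h5]
    refine div_le_div_of_nonneg_left h4 (by positivity) ?_
    rw [sq]
    exact mul_le_mul_of_nonneg_right (by linarith) h2.le
  have hsumle : ∀ k ω, ∑ j ∈ Finset.range k, ‖w j ω‖ ^ 2 ≤ 1 := by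
    intro k ω
    have h1 := Finset.sum_le_sum fun j (_ : j ∈ Finset.range k) => hwsq j ω
    rw [Finset.sum_range_sub'] at h1
    have h2 : (0 : ℝ) ≤ (1 + A k ω)⁻¹ := inv_nonneg.2 (by linarith [hA0 k ω])
    have h3 : A 0 ω = 0 := by simp [hA]
    rw [h3] at h1
    linarith [h1, (by norm_num : (1 + (0 : ℝ))⁻¹ = 1)]
  have hw1 : ∀ k ω, ‖w k ω‖ ≤ 1 := by
    intro k ω
    have h1 := (Finset.single_le_sum (f := fun j => ‖w j ω‖ ^ 2) (fun j _ => sq_nonneg _)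
      (Finset.self_mem_range_succ k)).trans (hsumle (k + 1) ω)
    exact (sq_le_one_iff₀ (norm_nonneg _)).1 h1
  have hwi : ∀ k, Integrable (fun ω => ‖w k ω‖ ^ 2) μ := fun k =>
    Integrable.of_bound (((hwm k).mono (ℱ.le _)).norm.pow 2).aestronglyMeasurable 1
      (Eventually.of_forall fun ω => by
        simpa using (sq_le_one_iff₀ (norm_nonneg _)).2 (hw1 k ω))
  have hs : Summable fun k => ∫ ω, ‖w k ω‖ ^ 2 ∂μ := by
    refine summable_of_sum_range_le (c := 1) (fun k => integral_nonneg fun ω => sq_nonneg _) ?_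
    intro k
    rw [← integral_finsetSum _ fun j _ => hwi j]
    refine (integral_mono (integrable_finsetSum _ fun j _ => hwi j) (integrable_const 1)
      fun ω => hsumle k ω).trans ?_
    simp
  filter_upwards [he.ae_exists_tendsto_sum_inner hwm hw1 hs] with ω ⟨c, hc⟩ ε hε
  refine eventually_abs_sum_le_of_tendsto (A := fun k => A k ω) (c := c) ?_ (by simp [hA]) ?_ hε
  · exact monotone_nat_of_le_succ fun k => by rw [hAs]; linarith [sq_nonneg ‖v k ω‖]
  · refine hc.congr fun k => Finset.sum_congr rfl fun j _ => ?_
    rw [hw, real_inner_smul_left, inv_mul_eq_div]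

/-- Square integrable stepsizes make the noise series converge in norm. -/
lemma IsNoise.ae_exists_tendsto_sum_smul {Ω : Type*} {n : ℕ} {m0 : MeasurableSpace Ω}
    {ℱ : Filtration ℕ m0} {μ : Measure Ω} [IsProbabilityMeasure μ] {σ : ℝ}
    {e : ℕ → Ω → EuclideanSpace ℝ (Fin n)} (he : IsNoise ℱ μ σ e) {t : ℕ → Ω → ℝ}
    (ht : ∀ k, StronglyMeasurable[ℱ k] (t k)) {B : ℝ} (hB : ∀ k ω, |t k ω| ≤ B)
    (hsum : Summable fun k => ∫ ω, t k ω ^ 2 ∂μ) :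
    ∀ᵐ ω ∂μ, ∃ c, Tendsto (fun k => ∑ j ∈ Finset.range k, t j ω • e j ω) atTop (𝓝 c) := by
  have key : ∀ i : Fin n, ∀ᵐ ω ∂μ, ∃ c,
      Tendsto (fun k => ∑ j ∈ Finset.range k, t j ω * e j ω i) atTop (𝓝 c) := by
    intro i
    have hn : ∀ k ω, ‖t k ω • EuclideanSpace.single i (1 : ℝ)‖ = |t k ω| := fun k ω => by
      simp [norm_smul]
    have := he.ae_exists_tendsto_sum_inner (B := B)
      (w := fun k ω => t k ω • EuclideanSpace.single i (1 : ℝ))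
      (fun k => (ht k).smul stronglyMeasurable_const) (fun k ω => by rw [hn]; exact hB k ω)
      (by simpa only [hn, sq_abs] using hsum)
    simpa [real_inner_smul_left, EuclideanSpace.inner_single_left] using this
  filter_upwards [ae_all_iff.2 key] with ω hω
  choose c hc using hω
  refine ⟨WithLp.toLp 2 c, ?_⟩
  have h1 : Tendsto (fun k i => ∑ j ∈ Finset.range k, t j ω * e j ω i) atTop (𝓝 c) :=
    tendsto_pi_nhds.2 hc
  refine (((PiLp.continuous_toLp 2 _).tendsto c).comp h1).congr fun k => ?_
  ext i
  simp

/-! ### The direction-finding subproblem -/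

/-- First order optimality condition of the subproblem at `(x, z)`: `y ∈ X` and
`-(z + β (y - x))` is normal to `X` at `y`. -/
def IsSubproblemSol {n : ℕ} (X : Set (EuclideanSpace ℝ (Fin n))) (β : ℝ)
    (x z y : EuclideanSpace ℝ (Fin n)) : Prop :=
  y ∈ X ∧ ∀ y' ∈ X, 0 ≤ ⟪z + β • (y - x), y' - y⟫_ℝ

section Subproblem

variable {n : ℕ} {X : Set (EuclideanSpace ℝ (Fin n))} {β : ℝ}

lemma subproblem_eq (x z y y' : EuclideanSpace ℝ (Fin n)) :
    subproblem β x z y' = subproblem β x z y + ⟪z + β • (y - x), y' - y⟫_ℝ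
      + β / 2 * ‖y' - y‖ ^ 2 := by
  have h : y' - x = (y - x) + (y' - y) := by abel
  rw [subproblem, subproblem, h, norm_add_sq_real, inner_add_right, inner_add_left,
    real_inner_smul_left]
  ring

lemma IsMinOn.isSubproblemSol (hX : Convex ℝ X) {x z y : EuclideanSpace ℝ (Fin n)} (hy : y ∈ X)
    (hmin : IsMinOn (subproblem β x z) X y) : IsSubproblemSol X β x z y := by
  refine ⟨hy, fun y' hy' => ?_⟩
  set g := ⟪z + β • (y - x), y' - y⟫_ℝ
  have key : ∀ t : ℝ, 0 < t → t ≤ 1 → 0 ≤ g + t * (β / 2 * ‖y' - y‖ ^ 2) := by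
    intro t ht ht1
    have hmem : y + t • (y' - y) ∈ X := hX.add_smul_sub_mem hy hy' ⟨ht.le, ht1⟩
    have h1 := isMinOn_iff.1 hmin _ hmem
    rw [subproblem_eq x z y (y + t • (y' - y)), add_sub_cancel_left, real_inner_smul_right,
      norm_smul, mul_pow, Real.norm_eq_abs, sq_abs] at h1
    have h2 : 0 ≤ t * (g + t * (β / 2 * ‖y' - y‖ ^ 2)) := by linarith
    exact nonneg_of_mul_nonneg_right h2 ht
  have hlim : Tendsto (fun t : ℝ => g + t * (β / 2 * ‖y' - y‖ ^ 2)) (𝓝[>] 0) (𝓝 g) := by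
    have : Continuous fun t : ℝ => g + t * (β / 2 * ‖y' - y‖ ^ 2) := by fun_prop
    simpa using (this.tendsto 0).mono_left nhdsWithin_le_nhds
  refine ge_of_tendsto hlim ?_
  filter_upwards [Ioc_mem_nhdsGT (zero_lt_one (α := ℝ))] with t ht using key t ht.1 ht.2

/-- The solution of the subproblem is a Lipschitz function of `x - z / β`, being the projection of
this point on `X`. -/
lemma IsSubproblemSol.norm_sub_le (hβ : 0 < β) {x₁ z₁ y₁ x₂ z₂ y₂ : EuclideanSpace ℝ (Fin n)}
    (h₁ : IsSubproblemSol X β x₁ z₁ y₁) (h₂ : IsSubproblemSol X β x₂ z₂ y₂) :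
    ‖y₁ - y₂‖ ≤ ‖(x₁ - x₂) - β⁻¹ • (z₁ - z₂)‖ := by
  have e₁ := h₁.2 y₂ h₂.1
  have e₂ := h₂.2 y₁ h₁.1
  set p := (x₁ - x₂) - β⁻¹ • (z₁ - z₂) with hp
  have hkey : ⟪z₁ + β • (y₁ - x₁), y₂ - y₁⟫_ℝ + ⟪z₂ + β • (y₂ - x₂), y₁ - y₂⟫_ℝ
      = β * ⟪p, y₁ - y₂⟫_ℝ - β * ‖y₁ - y₂‖ ^ 2 := by
    have a1 : y₂ - y₁ = -(y₁ - y₂) := by abel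
    have a2 : β • p = β • (x₁ - x₂) - (z₁ - z₂) := by
      rw [hp, smul_sub, smul_inv_smul₀ hβ.ne']
    rw [← real_inner_smul_left, a2, a1, inner_neg_right, ← real_inner_self_eq_norm_sq,
      ← real_inner_smul_left, neg_add_eq_sub, ← inner_sub_left, ← inner_sub_left]
    congr 1
    module
  have h3 : ‖y₁ - y₂‖ ^ 2 ≤ ⟪p, y₁ - y₂⟫_ℝ := by
    have : 0 ≤ β * (⟪p, y₁ - y₂⟫_ℝ - ‖y₁ - y₂‖ ^ 2) := by linarith
    linarith [nonneg_of_mul_nonneg_right this hβ]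
  have h4 := h3.trans (real_inner_le_norm p (y₁ - y₂))
  by_contra! hlt
  nlinarith [norm_nonneg p, norm_nonneg (y₁ - y₂)]

lemma exists_isSubproblemSol (hX : Convex ℝ X) (hXc : IsClosed X) (hne : X.Nonempty) (hβ : 0 < β)
    (x z : EuclideanSpace ℝ (Fin n)) : ∃ y, IsSubproblemSol X β x z y := by
  obtain ⟨y, hy, h⟩ := exists_norm_eq_iInf_of_complete_convex hne hXc.isComplete hX (x - β⁻¹ • z)
  refine ⟨y, hy, fun y' hy' => ?_⟩
  have h1 := (norm_eq_iInf_iff_real_inner_le_zero hX hy).1 h y' hy'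
  have h2 : z + β • (y - x) = -(β • (x - β⁻¹ • z - y)) := by
    rw [smul_sub β (x - _), smul_sub β x, smul_inv_smul₀ hβ.ne']; module
  rw [h2, inner_neg_left, real_inner_smul_left]
  linarith [mul_nonpos_of_nonneg_of_nonpos hβ.le h1]

lemma exists_continuous_isSubproblemSol (hX : Convex ℝ X) (hXc : IsClosed X) (hne : X.Nonempty)
    (hβ : 0 < β) : ∃ P : EuclideanSpace ℝ (Fin n) × EuclideanSpace ℝ (Fin n) →
      EuclideanSpace ℝ (Fin n), Continuous P ∧ ∀ p, IsSubproblemSol X β p.1 p.2 (P p) := by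
  choose P hP using fun p : EuclideanSpace ℝ (Fin n) × EuclideanSpace ℝ (Fin n) =>
    exists_isSubproblemSol hX hXc hne hβ p.1 p.2
  refine ⟨P, continuous_iff_continuousAt.2 fun p₀ => ?_, hP⟩
  have hcont : Continuous fun p : EuclideanSpace ℝ (Fin n) × EuclideanSpace ℝ (Fin n) =>
      ‖(p.1 - p₀.1) - β⁻¹ • (p.2 - p₀.2)‖ := by fun_prop
  refine tendsto_iff_norm_sub_tendsto_zero.2 (squeeze_zero (fun _ => norm_nonneg _)
    (fun p => (hP p).norm_sub_le hβ (hP p₀)) ?_)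
  simpa using hcont.tendsto p₀

lemma IsSubproblemSol.eq (hβ : 0 < β) {x z y₁ y₂ : EuclideanSpace ℝ (Fin n)}
    (h₁ : IsSubproblemSol X β x z y₁) (h₂ : IsSubproblemSol X β x z y₂) : y₁ = y₂ := by
  have := h₁.norm_sub_le hβ h₂
  simpa [sub_eq_zero] using this

lemma IsSubproblemSol.inner_le {x z y : EuclideanSpace ℝ (Fin n)}
    (hy : IsSubproblemSol X β x z y) (hx : x ∈ X) : ⟪z, y - x⟫_ℝ ≤ -β * ‖y - x‖ ^ 2 := by
  have h1 := hy.2 x hx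
  rw [← neg_sub y x, inner_neg_right, inner_add_left, real_inner_smul_left,
    real_inner_self_eq_norm_sq] at h1
  linarith

/-- The negative of the optimal value of the subproblem along one step of the method. The quadratic
error comes from minimizing over the unknown displacement `y' - y` of the solution. -/
lemma neg_subproblem_step (hβ : 0 < β) {x z y y' Δ : EuclideanSpace ℝ (Fin n)} {τ : ℝ}
    (hτ : 0 ≤ τ) (hy : IsSubproblemSol X β x z y) (hx : x ∈ X) (hy' : y' ∈ X) :
    -subproblem β (x + τ • (y - x)) (z + Δ) y' ≤ -subproblem β x z y - ⟪Δ, y - x⟫_ℝ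
      + (β⁻¹ + 1 / 2) * ‖Δ‖ ^ 2 + (β + 1 / 2) * τ ^ 2 * ‖y - x‖ ^ 2 := by
  have hvi := hy.2 y' hy'
  have hzd := hy.inner_le hx
  set d := y - x with hd
  set w := y' - y with hw
  have hφ := subproblem_eq (β := β) x z y y'
  rw [← hd, ← hw] at hφ
  have e1 : y' - (x + τ • d) = (1 - τ) • d + w := by rw [hd, hw]; module
  have e2 : y' - x = d + w := by rw [hd, hw]; abel
  have hφ' : subproblem β (x + τ • d) (z + Δ) y' = subproblem β x z y'
      + ⟪Δ, d⟫_ℝ + ⟪Δ, w⟫_ℝ - τ * ⟪z, d⟫_ℝ - τ * ⟪Δ, d⟫_ℝ - β * τ * ‖d‖ ^ 2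
      - β * τ * ⟪d, w⟫_ℝ + β / 2 * τ ^ 2 * ‖d‖ ^ 2 := by
    rw [subproblem, subproblem, e1, e2, norm_add_sq_real, norm_add_sq_real, norm_smul, mul_pow,
      Real.norm_eq_abs, sq_abs]
    simp only [inner_add_left, inner_add_right, real_inner_smul_left, real_inner_smul_right]
    ring
  clear_value d w
  -- complete the square in the displacement `w`
  have hsq : 0 ≤ β / 2 * ‖w‖ ^ 2 + (⟪Δ, w⟫_ℝ - β * τ * ⟪d, w⟫_ℝ)
      + (β⁻¹ * ‖Δ‖ ^ 2 + β * τ ^ 2 * ‖d‖ ^ 2) := by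
    have h1 : 0 ≤ ‖w + (β⁻¹ • Δ - τ • d)‖ ^ 2 := sq_nonneg _
    have h2 : 0 ≤ ‖β⁻¹ • Δ + τ • d‖ ^ 2 := sq_nonneg _
    rw [norm_add_sq_real, norm_sub_sq_real] at h1
    rw [norm_add_sq_real] at h2
    simp only [norm_smul, mul_pow, Real.norm_eq_abs, sq_abs, inner_sub_right,
      real_inner_smul_left, real_inner_smul_right] at h1 h2
    rw [← real_inner_comm Δ w, ← real_inner_comm d w]
    have h3 : 0 ≤ β / 2 * (‖w‖ ^ 2 + 2 * (β⁻¹ * ⟪w, Δ⟫_ℝ - τ * ⟪w, d⟫_ℝ)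
        + 2 * (β⁻¹ ^ 2 * ‖Δ‖ ^ 2 + τ ^ 2 * ‖d‖ ^ 2)) :=
      mul_nonneg (by linarith) (by linarith)
    have h4 : β * β⁻¹ = 1 := mul_inv_cancel₀ hβ.ne'
    have h5 : β / 2 * (‖w‖ ^ 2 + 2 * (β⁻¹ * ⟪w, Δ⟫_ℝ - τ * ⟪w, d⟫_ℝ)
        + 2 * (β⁻¹ ^ 2 * ‖Δ‖ ^ 2 + τ ^ 2 * ‖d‖ ^ 2))
        = β / 2 * ‖w‖ ^ 2 + ((β * β⁻¹) * ⟪w, Δ⟫_ℝ - β * τ * ⟪w, d⟫_ℝ)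
          + ((β * β⁻¹) * β⁻¹ * ‖Δ‖ ^ 2 + β * τ ^ 2 * ‖d‖ ^ 2) := by ring
    rw [h5, h4] at h3
    linarith
  have hcs : τ * ⟪Δ, d⟫_ℝ ≤ 1 / 2 * ‖Δ‖ ^ 2 + 1 / 2 * τ ^ 2 * ‖d‖ ^ 2 := by
    have h1 : 0 ≤ ‖Δ - τ • d‖ ^ 2 := sq_nonneg _
    rw [norm_sub_sq_real, norm_smul, mul_pow, Real.norm_eq_abs, sq_abs,
      real_inner_smul_right] at h1
    linarith
  have hz : τ * (⟪z, d⟫_ℝ + β * ‖d‖ ^ 2) ≤ 0 :=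
    mul_nonpos_of_nonneg_of_nonpos hτ (by linarith)
  have hq : 0 ≤ β / 2 * τ ^ 2 * ‖d‖ ^ 2 := by positivity
  rw [hφ', hφ]
  linarith

end Subproblem

/-! ### One step of the method decreases the merit function -/

/-- The weight of the squared averaging error in the merit function. It is small enough for the
drift of `∇f(x)` to be absorbed by the decrease of the objective. -/
noncomputable def meritWeight (a β : ℝ) (L : ℝ≥0) : ℝ := a ^ 2 * β / (8 * ((L : ℝ) ^ 2 + 1))

/-- The merit function `a f(x) - η(x, z) + c ‖∇f(x) - z‖²`, with `c = meritWeight a β L` and with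
`η(x, z)` the value of the subproblem at its solution `y`. -/
noncomputable def merit {n : ℕ} (f : EuclideanSpace ℝ (Fin n) → ℝ) (a β : ℝ) (L : ℝ≥0)
    (x z y : EuclideanSpace ℝ (Fin n)) : ℝ :=
  a * f x - subproblem β x z y + meritWeight a β L * ‖gradient f x - z‖ ^ 2

/-- The linear coefficient of the noise in the variation of the merit function. -/
noncomputable def noiseCoeff {n : ℕ} (f : EuclideanSpace ℝ (Fin n) → ℝ) (a β : ℝ) (L : ℝ≥0)
    (x z y : EuclideanSpace ℝ (Fin n)) : EuclideanSpace ℝ (Fin n) :=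
  a • (y - x) + (2 * meritWeight a β L * a) • (gradient f x - z)

lemma abs_sub_sub_inner_gradient_le {E : Type*} [NormedAddCommGroup E] [InnerProductSpace ℝ E]
    [CompleteSpace E] {f : E → ℝ} (hf : Differentiable ℝ f) {L : ℝ≥0}
    (hL : LipschitzWith L (gradient f)) (x h : E) :
    |f (x + h) - f x - ⟪gradient f x, h⟫_ℝ| ≤ L * ‖h‖ ^ 2 := by
  have hφ : ∀ y ∈ segment ℝ x (x + h), HasFDerivWithinAt f
      (InnerProductSpace.toDual ℝ E (gradient f y)) (segment ℝ x (x + h)) y := fun y _ =>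
    (hf y).hasGradientAt.hasFDerivAt.hasFDerivWithinAt
  have hb : ∀ y ∈ segment ℝ x (x + h), ‖InnerProductSpace.toDual ℝ E (gradient f y)
      - InnerProductSpace.toDual ℝ E (gradient f x)‖ ≤ L * ‖h‖ := by
    intro y hy
    rw [← map_sub, LinearIsometryEquiv.norm_map]
    refine (hL.norm_sub_le y x).trans (mul_le_mul_of_nonneg_left ?_ L.2)
    simpa using norm_sub_le_of_mem_segment hy
  have := (convex_segment x (x + h)).norm_image_sub_le_of_norm_hasFDerivWithin_le' hφ hb
    (left_mem_segment ℝ x (x + h)) (right_mem_segment ℝ x (x + h))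
  simpa [sq, mul_assoc] using this

lemma norm_add_three_sq_le {E : Type*} [SeminormedAddCommGroup E] (p q r : E) :
    ‖p + q + r‖ ^ 2 ≤ 3 * (‖p‖ ^ 2 + ‖q‖ ^ 2 + ‖r‖ ^ 2) := by
  have h : ‖p + q + r‖ ≤ ‖p‖ + ‖q‖ + ‖r‖ := norm_add₃_le
  have h2 := pow_le_pow_left₀ (norm_nonneg _) h 2
  nlinarith [sq_nonneg (‖p‖ - ‖q‖), sq_nonneg (‖q‖ - ‖r‖), sq_nonneg (‖p‖ - ‖r‖)]

section Step

variable {n : ℕ} {X : Set (EuclideanSpace ℝ (Fin n))} {f : EuclideanSpace ℝ (Fin n) → ℝ}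
  {L : ℝ≥0} {a β : ℝ}

/-- Contraction of the averaging error `∇f(x) - z` along one step, up to a drift controlled by the
displacement `d`, the oracle bias `b`, and the noise `e`. -/
lemma norm_gradient_sub_sq_step (hL : LipschitzWith L (gradient f)) (ha : 0 < a)
    (x z d b e : EuclideanSpace ℝ (Fin n)) {τ : ℝ} (hτ : 0 ≤ τ) :
    ‖gradient f (x + τ • d) - (z + (a * τ) • (gradient f x + b + e - z))‖ ^ 2
      ≤ ‖gradient f x - z‖ ^ 2 - a * τ * ‖gradient f x - z‖ ^ 2 + 2 * L ^ 2 / a * τ * ‖d‖ ^ 2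
        + 2 * a * τ * ‖b‖ ^ 2 - 2 * a * τ * ⟪gradient f x - z, e⟫_ℝ
        + τ ^ 2 * (4 * L ^ 2 * ‖d‖ ^ 2
          + 4 * a ^ 2 * (‖gradient f x - z‖ ^ 2 + ‖b‖ ^ 2 + ‖e‖ ^ 2)) := by
  set u := gradient f x - z with hu
  set q := gradient f (x + τ • d) - gradient f x with hq
  have hqn : ‖q‖ ≤ L * (τ * ‖d‖) := by
    have := hL.norm_sub_le (x + τ • d) x
    rwa [add_sub_cancel_left, norm_smul, Real.norm_of_nonneg hτ] at this
  have e1 : gradient f (x + τ • d) - (z + (a * τ) • (gradient f x + b + e - z))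
      = u + (q - (a * τ) • (u + b + e)) := by rw [hu, hq]; module
  have hr : ‖q - (a * τ) • (u + b + e)‖ ^ 2
      ≤ τ ^ 2 * (4 * L ^ 2 * ‖d‖ ^ 2 + 4 * a ^ 2 * (‖u‖ ^ 2 + ‖b‖ ^ 2 + ‖e‖ ^ 2)) := by
    have h1 : ‖q - (a * τ) • (u + b + e)‖ ≤ L * (τ * ‖d‖) + a * τ * (‖u‖ + ‖b‖ + ‖e‖) := by
      refine (norm_sub_le _ _).trans (add_le_add hqn ?_)
      rw [norm_smul, Real.norm_of_nonneg (by positivity)]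
      exact mul_le_mul_of_nonneg_left norm_add₃_le (by positivity)
    refine (pow_le_pow_left₀ (norm_nonneg _) h1 2).trans ?_
    have h2 : (L * (τ * ‖d‖) + a * τ * (‖u‖ + ‖b‖ + ‖e‖)) ^ 2
        = τ ^ 2 * (L * ‖d‖ + a * ‖u‖ + a * ‖b‖ + a * ‖e‖) ^ 2 := by ring
    rw [h2]
    refine mul_le_mul_of_nonneg_left ?_ (sq_nonneg _)
    have h3 : ∀ p q r s : ℝ, (p + q + r + s) ^ 2 ≤ 4 * (p ^ 2 + q ^ 2 + r ^ 2 + s ^ 2) :=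
      fun p q r s => by
        nlinarith [sq_nonneg (p - q), sq_nonneg (p - r), sq_nonneg (p - s), sq_nonneg (q - r),
          sq_nonneg (q - s), sq_nonneg (r - s)]
    refine (h3 _ _ _ _).trans (le_of_eq ?_)
    ring
  have hc1 : 2 * ⟪u, q⟫_ℝ ≤ a / 2 * τ * ‖u‖ ^ 2 + 2 * L ^ 2 / a * τ * ‖d‖ ^ 2 := by
    have h1 : ⟪u, q⟫_ℝ ≤ ‖u‖ * (L * (τ * ‖d‖)) :=
      (real_inner_le_norm _ _).trans (mul_le_mul_of_nonneg_left hqn (norm_nonneg _))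
    have h2 : 0 ≤ τ / (2 * a) * (a * ‖u‖ - 2 * L * ‖d‖) ^ 2 := by positivity
    have h3 : τ / (2 * a) * (a * ‖u‖ - 2 * L * ‖d‖) ^ 2
        = a / 2 * τ * ‖u‖ ^ 2 + 2 * L ^ 2 / a * τ * ‖d‖ ^ 2 - 2 * (‖u‖ * (L * (τ * ‖d‖))) := by
      field_simp
      ring
    linarith
  have hc2 : -(2 * (a * τ) * ⟪u, b⟫_ℝ) ≤ a / 2 * τ * ‖u‖ ^ 2 + 2 * a * τ * ‖b‖ ^ 2 := by
    have h1 := neg_le_of_abs_le (abs_real_inner_le_norm u b)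
    have h2 : 0 ≤ a * τ / 2 * (‖u‖ - 2 * ‖b‖) ^ 2 := by positivity
    have h3 : -(2 * (a * τ) * ⟪u, b⟫_ℝ) ≤ 2 * (a * τ) * (‖u‖ * ‖b‖) := by
      rw [← mul_neg]
      exact mul_le_mul_of_nonneg_left (by linarith) (by positivity)
    nlinarith
  rw [e1, norm_add_sq_real]
  simp only [inner_sub_right, inner_add_right, real_inner_smul_right,
    real_inner_self_eq_norm_sq]
  linarith

lemma meritWeight_pos (ha : 0 < a) (hβ : 0 < β) (L : ℝ≥0) : 0 < meritWeight a β L := by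
  rw [meritWeight]; positivity

lemma meritWeight_mul_le (ha : 0 < a) (hβ : 0 < β) (L : ℝ≥0) :
    meritWeight a β L * (2 * L ^ 2 / a) ≤ a * β / 4 := by
  have h1 : meritWeight a β L * (2 * L ^ 2 / a)
      = a * β / 4 * ((L : ℝ) ^ 2 / ((L : ℝ) ^ 2 + 1)) := by
    rw [meritWeight]; field_simp; ring
  rw [h1]
  refine mul_le_of_le_one_right (by positivity) ((div_le_one (by positivity)).2 (by linarith))

/-- The variation of `a f - η` along one step. -/
lemma objective_sub_subproblem_step (hf : Differentiable ℝ f) (hL : LipschitzWith L (gradient f))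
    (ha : 0 < a) (hβ : 0 < β) {x z y y' b e : EuclideanSpace ℝ (Fin n)} {τ : ℝ}
    (hτ : 0 ≤ τ) (hx : x ∈ X) (hy : IsSubproblemSol X β x z y) (hy' : y' ∈ X) :
    a * f (x + τ • (y - x))
        - subproblem β (x + τ • (y - x)) (z + (a * τ) • (gradient f x + b + e - z)) y'
      ≤ a * f x - subproblem β x z y - a * β / 2 * τ * ‖y - x‖ ^ 2
        + a / (2 * β) * τ * ‖b‖ ^ 2 - a * τ * ⟪y - x, e⟫_ℝ
        + (a * L + β + 1 / 2 + 3 * a ^ 2 * (β⁻¹ + 1 / 2))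
          * τ ^ 2 * (‖y - x‖ ^ 2 + ‖gradient f x - z‖ ^ 2 + ‖b‖ ^ 2 + ‖e‖ ^ 2) := by
  have hη := neg_subproblem_step (Δ := (a * τ) • (gradient f x + b + e - z)) hβ hτ hy hx hy'
  have hfs := (abs_le.1 (abs_sub_sub_inner_gradient_le hf hL x (τ • (y - x)))).2
  have hzd := hy.inner_le hx
  have hΔ : gradient f x + b + e - z = (gradient f x - z) + b + e := by abel
  have hgd : ⟪gradient f x, y - x⟫_ℝ = ⟪gradient f x - z, y - x⟫_ℝ + ⟪z, y - x⟫_ℝ := by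
    rw [← inner_add_left, sub_add_cancel]
  rw [hΔ] at hη ⊢
  generalize y - x = d at *
  generalize gradient f x - z = u at *
  have hΔn : ‖(a * τ) • (u + b + e)‖ ^ 2
      ≤ τ ^ 2 * (3 * a ^ 2 * (‖u‖ ^ 2 + ‖b‖ ^ 2 + ‖e‖ ^ 2)) := by
    rw [norm_smul, mul_pow, Real.norm_eq_abs, sq_abs]
    have := mul_le_mul_of_nonneg_left (norm_add_three_sq_le u b e) (sq_nonneg (a * τ))
    linarith
  have hΔn' := mul_le_mul_of_nonneg_left hΔn (show 0 ≤ β⁻¹ + 1 / 2 by positivity)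
  rw [real_inner_smul_right, norm_smul, mul_pow, Real.norm_eq_abs, sq_abs, hgd] at hfs
  have hfs' := mul_le_mul_of_nonneg_left hfs ha.le
  have hzd' := mul_le_mul_of_nonneg_left hzd (show 0 ≤ a * τ by positivity)
  have hbd : -(a * τ * ⟪b, d⟫_ℝ) ≤ a * τ * (β / 2 * ‖d‖ ^ 2 + 1 / (2 * β) * ‖b‖ ^ 2) := by
    rw [← mul_neg]
    refine mul_le_mul_of_nonneg_left ?_ (by positivity)
    have h1 := neg_le_of_abs_le (abs_real_inner_le_norm b d)
    have h2 : 0 ≤ 1 / (2 * β) * (β * ‖d‖ - ‖b‖) ^ 2 := by positivity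
    have h3 : 1 / (2 * β) * (β * ‖d‖ - ‖b‖) ^ 2
        = β / 2 * ‖d‖ ^ 2 + 1 / (2 * β) * ‖b‖ ^ 2 - ‖b‖ * ‖d‖ := by field_simp; ring
    linarith
  have hab : a * τ * (1 / (2 * β) * ‖b‖ ^ 2) = a / (2 * β) * τ * ‖b‖ ^ 2 := by ring
  rw [mul_add, hab] at hbd
  have hr : (a * L + β + 1 / 2) * τ ^ 2 * ‖d‖ ^ 2
      + (β⁻¹ + 1 / 2) * (τ ^ 2 * (3 * a ^ 2 * (‖u‖ ^ 2 + ‖b‖ ^ 2 + ‖e‖ ^ 2)))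
      ≤ (a * L + β + 1 / 2 + 3 * a ^ 2 * (β⁻¹ + 1 / 2))
          * τ ^ 2 * (‖d‖ ^ 2 + ‖u‖ ^ 2 + ‖b‖ ^ 2 + ‖e‖ ^ 2) := by
    have h1 : 0 ≤ (a * L + β + 1 / 2) * τ ^ 2 * (‖u‖ ^ 2 + ‖b‖ ^ 2 + ‖e‖ ^ 2) := by positivity
    have h2 : 0 ≤ 3 * a ^ 2 * (β⁻¹ + 1 / 2) * τ ^ 2 * ‖d‖ ^ 2 := by positivity
    linarith
  simp only [real_inner_smul_left, inner_add_left] at hη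
  rw [real_inner_comm e d]
  linarith

/-- Descent of the merit function: at first order it decreases by a multiple of
`‖y - x‖² + ‖∇f(x) - z‖²`, apart from a noise term linear in `e`. -/
lemma exists_merit_step_le (hf : Differentiable ℝ f) (hL : LipschitzWith L (gradient f))
    (ha : 0 < a) (hβ : 0 < β) : ∃ κ > 0, ∃ C ≥ 0, ∀ (x z y y' b e : EuclideanSpace ℝ (Fin n))
      (τ : ℝ), 0 ≤ τ → τ ≤ 1 → x ∈ X → IsSubproblemSol X β x z y → y' ∈ X →
      merit f a β L (x + τ • (y - x)) (z + (a * τ) • (gradient f x + b + e - z)) y'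
        ≤ merit f a β L x z y - κ * (τ * (‖y - x‖ ^ 2 + ‖gradient f x - z‖ ^ 2))
          + C * (τ ^ 2 * (‖y - x‖ ^ 2 + ‖gradient f x - z‖ ^ 2))
          + C * (τ * ‖b‖ ^ 2 + τ ^ 2 * ‖e‖ ^ 2) - τ * ⟪noiseCoeff f a β L x z y, e⟫_ℝ := by
  have hc0 := meritWeight_pos ha hβ L
  have hcL := meritWeight_mul_le ha hβ L
  obtain ⟨K₁, hK₁⟩ : ∃ K, K = a * L + β + 1 / 2 + 3 * a ^ 2 * (β⁻¹ + 1 / 2) := ⟨_, rfl⟩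
  obtain ⟨K₂, hK₂⟩ : ∃ K : ℝ, K = 4 * L ^ 2 + 4 * a ^ 2 := ⟨_, rfl⟩
  have hK₁0 : 0 ≤ K₁ := by rw [hK₁]; positivity
  have hK₂0 : 0 ≤ K₂ := by rw [hK₂]; positivity
  unfold merit noiseCoeff
  generalize meritWeight a β L = c at *
  have hp : 0 ≤ a / (2 * β) + 2 * a * c := by positivity
  refine ⟨min (a * β / 4) (c * a), by positivity, a / (2 * β) + 2 * a * c + (K₁ + c * K₂),
    by positivity, ?_⟩
  intro x z y y' b e τ hτ hτ1 hx hy hy'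
  have hη := objective_sub_subproblem_step (b := b) (e := e) hf hL ha hβ hτ hx hy hy'
  have hu := mul_le_mul_of_nonneg_left
    (norm_gradient_sub_sq_step hL ha x z (y - x) b e hτ) hc0.le
  rw [← hK₁] at hη
  rw [inner_add_left, real_inner_smul_left, real_inner_smul_left]
  have hd0 := sq_nonneg ‖y - x‖
  have hu0 := sq_nonneg ‖gradient f x - z‖
  have hb0 := sq_nonneg ‖b‖
  have he0 := sq_nonneg ‖e‖
  generalize ‖gradient f (x + τ • (y - x))
    - (z + (a * τ) • (gradient f x + b + e - z))‖ ^ 2 = V at *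
  generalize a * f (x + τ • (y - x))
    - subproblem β (x + τ • (y - x)) (z + (a * τ) • (gradient f x + b + e - z)) y' = F at *
  generalize a * f x - subproblem β x z y = G at *
  generalize ⟪y - x, e⟫_ℝ = i₁ at *
  generalize ⟪gradient f x - z, e⟫_ℝ = i₂ at *
  generalize ‖y - x‖ ^ 2 = D at *
  generalize ‖gradient f x - z‖ ^ 2 = U at *
  generalize ‖b‖ ^ 2 = B at *
  generalize ‖e‖ ^ 2 = E at *
  have hmL := mul_le_mul_of_nonneg_right hcL (show 0 ≤ τ * D by positivity)
  have hm1 := mul_le_mul_of_nonneg_right (min_le_left (a * β / 4) (c * a))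
    (show 0 ≤ τ * D by positivity)
  have hm2 := mul_le_mul_of_nonneg_right (min_le_right (a * β / 4) (c * a))
    (show 0 ≤ τ * U by positivity)
  have hττ : τ ^ 2 * B ≤ τ * B := mul_le_mul_of_nonneg_right (by nlinarith) hb0
  have hr2 : τ ^ 2 * (4 * L ^ 2 * D + 4 * a ^ 2 * (U + B + E))
      ≤ K₂ * (τ ^ 2 * (D + U + B + E)) := by
    have h1 : 0 ≤ τ ^ 2 * (4 * (L : ℝ) ^ 2 * (U + B + E)) := by positivity
    have h2 : 0 ≤ τ ^ 2 * (4 * a ^ 2 * D) := by positivity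
    rw [hK₂]
    linarith
  have hr2' := mul_le_mul_of_nonneg_left hr2 hc0.le
  have hQ : τ ^ 2 * (D + U + B + E) ≤ τ ^ 2 * (D + U) + (τ * B + τ ^ 2 * E) := by linarith
  have hQ' := mul_le_mul_of_nonneg_left hQ (show 0 ≤ K₁ + c * K₂ by positivity)
  have hB : (a / (2 * β) + 2 * a * c) * (τ * B)
      ≤ (a / (2 * β) + 2 * a * c) * (τ ^ 2 * (D + U) + (τ * B + τ ^ 2 * E)) := by
    refine mul_le_mul_of_nonneg_left ?_ hp
    have : 0 ≤ τ ^ 2 * (D + U) := by positivity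
    have : 0 ≤ τ ^ 2 * E := by positivity
    linarith
  generalize min (a * β / 4) (c * a) = κ at *
  generalize a / (2 * β) = p at *
  generalize 2 * (L : ℝ) ^ 2 / a = q at *
  linarith

end Step

/-! ### Consequences of descent along one trajectory -/

/-- A perturbed descent recursion whose Lyapunov value does not tend to `-∞` has summable decrease.
The perturbation `m` is only controlled by the second order quantities `τ² D`, which the decrease
`τ D` dominates since `τ → 0`. -/
lemma summable_of_descent {W τ D r m : ℕ → ℝ} {κ C w : ℝ} (hκ : 0 < κ)
    (hτ0 : ∀ k, 0 ≤ τ k) (hτ1 : ∀ k, τ k ≤ 1) (hD : ∀ k, 0 ≤ D k) (hτ : Tendsto τ atTop (𝓝 0))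
    (hr0 : ∀ k, 0 ≤ r k) (hr : Summable r)
    (hW : ∀ k, W (k + 1) ≤ W k - κ * (τ k * D k) + C * (τ k ^ 2 * D k) + r k - m k)
    (hm : ∀ ε > 0, ∃ B, ∀ᶠ k in atTop, |∑ j ∈ Finset.range k, m j|
      ≤ ε * ∑ j ∈ Finset.range k, τ j ^ 2 * D j + B)
    (hw : ∃ᶠ k in atTop, w ≤ W k) : Summable fun k => τ k * D k := by
  have hτD : ∀ k, 0 ≤ τ k * D k := fun k => mul_nonneg (hτ0 k) (hD k)
  have hsmall : ∀ᶠ k in atTop, C * τ k ≤ κ / 2 := by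
    have : Tendsto (fun k => C * τ k) atTop (𝓝 0) := by simpa using hτ.const_mul C
    exact this.eventually_le_const (by linarith)
  obtain ⟨J, hJ⟩ := eventually_atTop.1 hsmall
  obtain ⟨B, hB⟩ := hm (κ / 4) (by linarith)
  set S : ℕ → ℝ := fun k => ∑ j ∈ Finset.range k, τ j * D j with hS
  set N : ℕ → ℝ := fun k => ∑ j ∈ Finset.range k, m j with hN
  set R : ℕ → ℝ := fun k => ∑ j ∈ Finset.range k, r j with hR
  have hSmono : Monotone S := monotone_nat_of_le_succ fun k => by
    simp only [hS, Finset.sum_range_succ]; linarith [hτD k]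
  have htel : ∀ k, J ≤ k → W k ≤ W J - κ / 2 * (S k - S J) + (R k - R J) - (N k - N J) := by
    intro k hk
    induction k, hk using Nat.le_induction with
    | base => simp
    | succ k hk ih =>
      have h1 := mul_le_mul_of_nonneg_right (hJ k hk) (hτD k)
      have h2 := hW k
      simp only [hS, hN, hR, Finset.sum_range_succ] at ih ⊢
      linarith
  have hA : ∀ k, ∑ j ∈ Finset.range k, τ j ^ 2 * D j ≤ S k := fun k =>
    Finset.sum_le_sum fun j _ =>
      mul_le_mul_of_nonneg_right (by nlinarith [hτ0 j, hτ1 j]) (hD j)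
  have hRle : ∀ k, R k ≤ ∑' j, r j := fun k => hr.sum_le_tsum _ fun j _ => hr0 j
  set T := 4 / κ * (W J + κ / 2 * S J + (∑' j, r j - R J) + N J + B - w) with hT
  have hfreq : ∃ᶠ k in atTop, S k ≤ T := by
    refine (hw.and_eventually (hB.and (eventually_ge_atTop J))).mono ?_
    rintro k ⟨h1, h2, h3⟩
    have h4 := htel k h3
    have h5 := neg_le_of_abs_le h2
    have h6 := mul_le_mul_of_nonneg_left (hA k) (show 0 ≤ κ / 4 by linarith)
    have h7 : κ / 4 * S k ≤ κ / 4 * T := by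
      have : κ / 4 * T = W J + κ / 2 * S J + (∑' j, r j - R J) + N J + B - w := by
        rw [hT]; field_simp
      rw [this]
      linarith [hRle k]
    exact le_of_mul_le_mul_left h7 (by linarith)
  refine summable_of_sum_range_le (c := T) hτD fun k => ?_
  obtain ⟨l, hl, hlT⟩ := frequently_atTop.1 hfreq k
  exact (hSmono hl).trans hlT

/-- If the trajectory `p` moves with speed at most `κ (1 + D)`, up to a convergent perturbation, and
`∑ τ D < ∞` while `∑ τ = ∞`, then `D` vanishes at all cluster points: around a point where `D > 0`
the trajectory would be trapped, since leaving a neighbourhood costs a fixed amount of `∑ τ D`. -/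
lemma nonpos_of_mapClusterPt {F : Type*} [NormedAddCommGroup F] [NormedSpace ℝ F] {p h ν : ℕ → F}
    {τ : ℕ → ℝ} {D : F → ℝ} {κ : ℝ} {c q : F} (hD : Continuous D)
    (hκ : 0 ≤ κ) (hτ0 : ∀ k, 0 ≤ τ k) (hτ : ¬ Summable τ)
    (hsum : Summable fun k => τ k * D (p k)) (hp : ∀ k, p (k + 1) = p k + τ k • h k + ν k)
    (hh : ∀ k, ‖h k‖ ≤ κ * (1 + D (p k)))
    (hν : Tendsto (fun k => ∑ j ∈ Finset.range k, ν j) atTop (𝓝 c))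
    (hq : MapClusterPt q atTop p) : D q ≤ 0 := by
  by_contra! hpos
  obtain ⟨δ, hδ0, hδ⟩ : ∃ δ > 0, δ < D q := ⟨D q / 2, by linarith, by linarith⟩
  obtain ⟨ε, hε, hball⟩ := Metric.eventually_nhds_iff.1 (hD.continuousAt.eventually_const_lt hδ)
  set S : ℕ → ℝ := fun k => ∑ j ∈ Finset.range k, τ j * D (p j) with hS
  set V : ℕ → F := fun k => ∑ j ∈ Finset.range k, ν j with hV
  set M := κ * (1 / δ + 1) with hM
  have hM0 : 0 ≤ M := by positivity
  obtain ⟨J₁, hJ₁⟩ := Metric.cauchySeq_iff.1 hsum.hasSum.tendsto_sum_nat.cauchySeq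
    (ε / (4 * (M + 1))) (by positivity)
  obtain ⟨J₂, hJ₂⟩ := Metric.cauchySeq_iff.1 hν.cauchySeq (ε / 4) (by positivity)
  have hnear : ∃ᶠ k in atTop, dist (p k) q < ε / 4 :=
    hq.frequently (Metric.ball_mem_nhds q (by positivity))
  obtain ⟨k, hk, hkq⟩ := frequently_atTop.1 hnear (max J₁ J₂)
  have hstay : ∀ i, k ≤ i → ‖p i - p k - (V i - V k)‖ ≤ M * (S i - S k) → dist (p i) q < ε := by
    intro i hi hle
    have h1 : |S i - S k| < ε / (4 * (M + 1)) :=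
      hJ₁ i ((le_max_left _ _).trans (hk.trans hi)) k ((le_max_left _ _).trans hk)
    have h2 : ‖V i - V k‖ < ε / 4 := by
      rw [← dist_eq_norm]
      exact hJ₂ i ((le_max_right _ _).trans (hk.trans hi)) k ((le_max_right _ _).trans hk)
    have h3 : M * (S i - S k) ≤ ε / 4 := by
      refine (mul_le_mul_of_nonneg_left ((le_abs_self _).trans h1.le) hM0).trans ?_
      rw [mul_div_assoc', div_le_div_iff₀ (by positivity) (by norm_num)]
      nlinarith
    have h4 : ‖p i - p k‖ ≤ ‖p i - p k - (V i - V k)‖ + ‖V i - V k‖ := by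
      simpa using norm_add_le (p i - p k - (V i - V k)) (V i - V k)
    have h5 := dist_triangle (p i) (p k) q
    rw [dist_eq_norm (p i) (p k)] at h5
    linarith
  have htrap : ∀ i, k ≤ i → ‖p i - p k - (V i - V k)‖ ≤ M * (S i - S k) := by
    intro i hi
    induction i, hi using Nat.le_induction with
    | base => simp
    | succ i hi ih =>
      have hDi : δ < D (p i) := hball (hstay i hi ih)
      have e1 : p (i + 1) - p k - (V (i + 1) - V k) = (p i - p k - (V i - V k)) + τ i • h i := by
        simp only [hV, Finset.sum_range_succ, hp]; abel
      have e2 : S (i + 1) = S i + τ i * D (p i) := Finset.sum_range_succ _ _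
      have h1 : 1 ≤ 1 / δ * D (p i) := by
        rw [one_div, inv_mul_eq_div, le_div_iff₀ hδ0]; linarith
      have h2 : ‖τ i • h i‖ ≤ M * (τ i * D (p i)) := by
        rw [norm_smul, Real.norm_of_nonneg (hτ0 i)]
        calc τ i * ‖h i‖ ≤ τ i * (κ * (1 / δ * D (p i) + D (p i))) :=
              mul_le_mul_of_nonneg_left ((hh i).trans
                (mul_le_mul_of_nonneg_left (by linarith) hκ)) (hτ0 i)
          _ = M * (τ i * D (p i)) := by rw [hM]; ring
      rw [e1, e2]
      refine (norm_add_le _ _).trans ?_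
      linarith
  refine hτ ((summable_nat_add_iff k).1 (Summable.of_nonneg_of_le (fun i => hτ0 _) (fun i => ?_)
    (((summable_nat_add_iff k).2 hsum).mul_left (1 / δ))))
  have hDi : δ < D (p (i + k)) :=
    hball (hstay _ (Nat.le_add_left k i) (htrap _ (Nat.le_add_left k i)))
  rw [one_div, inv_mul_eq_div, le_div_iff₀ hδ0]
  exact mul_le_mul_of_nonneg_left hDi.le (hτ0 _)

/-- Convergence along one trajectory. The iterates stay in `X`, the oracle answers have bias `b` and
noise `e`, and the hypotheses on the noise are those that hold almost surely. -/
theorem mem_normalCone_of_mapClusterPt {n : ℕ} {X : Set (EuclideanSpace ℝ (Fin n))}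
    (hXconv : Convex ℝ X) (hXclosed : IsClosed X)
    {f : EuclideanSpace ℝ (Fin n) → ℝ} (hf : Differentiable ℝ f) {L : ℝ≥0}
    (hL : LipschitzWith L (gradient f)) {a β : ℝ} (ha : 0 < a) (hβ : 0 < β)
    {τ : ℕ → ℝ} {x z y b e : ℕ → EuclideanSpace ℝ (Fin n)}
    (hτ0 : ∀ k, 0 ≤ τ k) (hτ1 : ∀ k, τ k ≤ 1) (hτlim : Tendsto τ atTop (𝓝 0)) (hτ : ¬ Summable τ)
    (hx : ∀ k, x k ∈ X) (hy : ∀ k, IsSubproblemSol X β (x k) (z k) (y k))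
    (hxs : ∀ k, x (k + 1) = x k + τ k • (y k - x k))
    (hzs : ∀ k, z (k + 1) = z k + (a * τ k) • (gradient f (x k) + b k + e k - z k))
    (hb : Summable fun k => τ k * ‖b k‖) (hb2 : Summable fun k => τ k * ‖b k‖ ^ 2)
    (he : ∃ c, Tendsto (fun k => ∑ j ∈ Finset.range k, τ j • e j) atTop (𝓝 c))
    (he2 : Summable fun k => τ k ^ 2 * ‖e k‖ ^ 2)
    (hlaw : ∀ ε > 0, ∃ B, ∀ᶠ k in atTop,
      |∑ j ∈ Finset.range k, τ j * ⟪noiseCoeff f a β L (x j) (z j) (y j), e j⟫_ℝ|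
        ≤ ε * ∑ j ∈ Finset.range k, τ j ^ 2 * ‖noiseCoeff f a β L (x j) (z j) (y j)‖ ^ 2 + B)
    {xs zs : EuclideanSpace ℝ (Fin n)}
    (hcl : MapClusterPt (xs, zs) atTop fun k => (x k, z k)) :
    zs = gradient f xs ∧ -zs ∈ normalCone X xs := by
  have hgc : Continuous (gradient f) := hL.continuous
  have hfc : Continuous f := hf.continuous
  obtain ⟨P, hPc, hP⟩ := exists_continuous_isSubproblemSol hXconv hXclosed ⟨x 0, hx 0⟩ hβ
  have hyP : ∀ k, y k = P (x k, z k) := fun k => (hy k).eq hβ (hP (x k, z k))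
  set D : EuclideanSpace ℝ (Fin n) × EuclideanSpace ℝ (Fin n) → ℝ := fun p =>
    ‖P p - p.1‖ ^ 2 + ‖gradient f p.1 - p.2‖ ^ 2 with hD
  have hDc : Continuous D := by fun_prop
  have hD0 : ∀ p, 0 ≤ D p := fun p => by positivity
  have hDk : ∀ k, ‖y k - x k‖ ^ 2 + ‖gradient f (x k) - z k‖ ^ 2 = D (x k, z k) := fun k => by
    simp only [hD, hyP]
  obtain ⟨κ, hκ, C, hC, hstep⟩ := exists_merit_step_le (X := X) hf hL ha hβ
  have hsum : Summable fun k => τ k * D (x k, z k) := by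
    set c := meritWeight a β L with hc
    set C₃ := 2 * a ^ 2 + 2 * (2 * c * a) ^ 2 with hC₃
    have hC₃0 : 0 < C₃ := by positivity
    have hv : ∀ k, ‖noiseCoeff f a β L (x k) (z k) (y k)‖ ^ 2 ≤ C₃ * D (x k, z k) := by
      intro k
      rw [← hDk, noiseCoeff, ← hc]
      have h1 := parallelogram_law_with_norm ℝ (a • (y k - x k))
        ((2 * c * a) • (gradient f (x k) - z k))
      simp only [norm_smul, mul_pow, Real.norm_eq_abs, sq_abs] at h1
      have h2 := sq_nonneg ‖a • (y k - x k) - (2 * c * a) • (gradient f (x k) - z k)‖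
      have h3 : 0 ≤ 2 * a ^ 2 * ‖gradient f (x k) - z k‖ ^ 2 := by positivity
      have h4 : 0 ≤ 2 * (2 * c * a) ^ 2 * ‖y k - x k‖ ^ 2 := by positivity
      rw [hC₃]
      linarith
    -- the merit function is continuous, hence does not tend to `-∞` along the trajectory
    set Wf : EuclideanSpace ℝ (Fin n) × EuclideanSpace ℝ (Fin n) → ℝ := fun p =>
      merit f a β L p.1 p.2 (P p) with hWf
    have hWc : Continuous Wf := by
      simp only [hWf, merit, subproblem]; fun_prop
    have hfreq : ∃ᶠ k in atTop, Wf (xs, zs) - 1 ≤ Wf (x k, z k) :=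
      hcl.frequently (hWc.continuousAt.eventually_const_le (by linarith))
    refine summable_of_descent (W := fun k => Wf (x k, z k)) (C := C) hκ hτ0 hτ1
      (fun k => hD0 _) hτlim
      (r := fun k => C * (τ k * ‖b k‖ ^ 2 + τ k ^ 2 * ‖e k‖ ^ 2))
      (m := fun k => τ k * ⟪noiseCoeff f a β L (x k) (z k) (y k), e k⟫_ℝ)
      (fun k => mul_nonneg hC (add_nonneg (mul_nonneg (hτ0 k) (sq_nonneg _)) (by positivity)))
      ((hb2.add he2).mul_left C) (fun k => ?_) (fun ε hε => ?_) hfreq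
    · have h1 := hstep (x k) (z k) (y k) (y (k + 1)) (b k) (e k) (τ k) (hτ0 k) (hτ1 k) (hx k)
        (hy k) (hy (k + 1)).1
      rw [← hxs, ← hzs, hDk] at h1
      simp only [hWf, ← hyP]
      exact h1
    · obtain ⟨B, hB⟩ := hlaw (ε / C₃) (by positivity)
      refine ⟨B, hB.mono fun k hk => hk.trans ?_⟩
      refine add_le_add_left ?_ B
      rw [Finset.mul_sum, Finset.mul_sum]
      refine Finset.sum_le_sum fun j _ => ?_
      have := mul_le_mul_of_nonneg_left (hv j) (show 0 ≤ ε / C₃ * τ j ^ 2 by positivity)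
      have e1 : ε / C₃ * τ j ^ 2 * (C₃ * D (x j, z j)) = ε * (τ j ^ 2 * D (x j, z j)) := by
        field_simp
      linarith
  have hDle : D (xs, zs) ≤ 0 := by
    obtain ⟨c, hc⟩ := he
    have hbs : Summable fun k => τ k • b k :=
      Summable.of_norm (hb.congr fun k => by rw [norm_smul, Real.norm_of_nonneg (hτ0 k)])
    have hν : Tendsto (fun k => ∑ j ∈ Finset.range k,
        ((0 : EuclideanSpace ℝ (Fin n)), a • (τ j • b j + τ j • e j))) atTop
        (𝓝 (0, a • (∑' j, τ j • b j + c))) := by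
      have h2 := (hbs.hasSum.tendsto_sum_nat.add hc).const_smul a
      refine (tendsto_const_nhds.prodMk_nhds h2).congr fun k => ?_
      refine Prod.ext ?_ ?_
      · simp [Prod.fst_sum]
      · simp [Prod.snd_sum, Finset.smul_sum, Finset.sum_add_distrib]
    refine nonpos_of_mapClusterPt (p := fun k => (x k, z k)) (κ := max 1 a) hDc
      (by positivity) hτ0 hτ hsum (h := fun k => (y k - x k, a • (gradient f (x k) - z k)))
      (fun k => ?_) (fun k => ?_) hν hcl
    · simp only [hxs k, hzs k, Prod.smul_mk, Prod.mk_add_mk, add_zero]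
      refine Prod.ext rfl ?_
      module
    · rw [← hDk, Prod.norm_def, norm_smul, Real.norm_of_nonneg ha.le]
      have h1 : ∀ s t : ℝ, s ≤ 1 + (s ^ 2 + t ^ 2) := fun s t => by
        nlinarith [sq_nonneg (s - 1 / 2), sq_nonneg t]
      have h2 : 0 ≤ 1 + (‖y k - x k‖ ^ 2 + ‖gradient f (x k) - z k‖ ^ 2) := by positivity
      refine max_le ?_ ?_
      · calc ‖y k - x k‖ ≤ 1 * (1 + (‖y k - x k‖ ^ 2 + ‖gradient f (x k) - z k‖ ^ 2)) := by
              rw [one_mul]; exact h1 _ _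
          _ ≤ _ := mul_le_mul_of_nonneg_right (le_max_left _ _) h2
      · calc a * ‖gradient f (x k) - z k‖
            ≤ a * (1 + (‖y k - x k‖ ^ 2 + ‖gradient f (x k) - z k‖ ^ 2)) := by
              refine mul_le_mul_of_nonneg_left ?_ ha.le
              rw [add_comm (‖y k - x k‖ ^ 2)]; exact h1 _ _
          _ ≤ _ := mul_le_mul_of_nonneg_right (le_max_right _ _) h2
  have h1 : ‖P (xs, zs) - xs‖ ^ 2 + ‖gradient f xs - zs‖ ^ 2 ≤ 0 := hDle
  have h2 : P (xs, zs) = xs := by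
    have : ‖P (xs, zs) - xs‖ ^ 2 = 0 :=
      le_antisymm (by linarith [sq_nonneg ‖gradient f xs - zs‖]) (sq_nonneg _)
    exact sub_eq_zero.1 (norm_eq_zero.1 (pow_eq_zero_iff two_ne_zero |>.1 this))
  have h3 : gradient f xs = zs := by
    have : ‖gradient f xs - zs‖ ^ 2 = 0 :=
      le_antisymm (by linarith [sq_nonneg ‖P (xs, zs) - xs‖]) (sq_nonneg _)
    exact sub_eq_zero.1 (norm_eq_zero.1 (pow_eq_zero_iff two_ne_zero |>.1 this))
  have h4 := hP (xs, zs)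
  rw [h2] at h4
  refine ⟨h3.symm, h4.1, fun y' hy' => ?_⟩
  have h5 := h4.2 y' hy'
  simp only [sub_self, smul_zero, add_zero] at h5
  rw [inner_neg_left]
  linarith

/-! ### The feasible companion of the iterates -/

/-- Companion of the iterates which stays in `X` by truncating the stepsizes at `1`. The iterates
themselves may leave `X` as long as `τ k > 1`. -/
noncomputable def companion {n : ℕ} {Ω : Type*} (τ : ℕ → Ω → ℝ)
    (x y : ℕ → Ω → EuclideanSpace ℝ (Fin n)) : ℕ → Ω → EuclideanSpace ℝ (Fin n)
  | 0, ω => x 0 ω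
  | k + 1, ω => companion τ x y k ω + min (τ k ω) 1 • (y k ω - companion τ x y k ω)

/-- The average `z` corrected so that `y` solves the subproblem at the companion of `x`. -/
noncomputable def companionAvg {n : ℕ} {Ω : Type*} (β : ℝ) (τ : ℕ → Ω → ℝ)
    (x y z : ℕ → Ω → EuclideanSpace ℝ (Fin n)) (k : ℕ) (ω : Ω) : EuclideanSpace ℝ (Fin n) :=
  z k ω - β • (x k ω - companion τ x y k ω)

lemma summable_mul_and_tendsto_zero_of_contraction {τ ρ : ℕ → ℝ} (hτ0 : ∀ k, 0 ≤ τ k)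
    (hτ : ¬ Summable τ) (hρ0 : ∀ k, 0 ≤ ρ k)
    (hρ : ∀ k, ρ (k + 1) = (1 - τ k) * ρ k) :
    (Summable fun k => τ k * ρ k) ∧ Tendsto ρ atTop (𝓝 0) := by
  have hdiff : ∀ k, τ k * ρ k = ρ k - ρ (k + 1) := fun k => by rw [hρ]; ring
  have hs : Summable fun k => τ k * ρ k := by
    refine summable_of_sum_range_le (c := ρ 0) (fun k => mul_nonneg (hτ0 k) (hρ0 k)) fun k => ?_
    simp_rw [hdiff]
    rw [Finset.sum_range_sub']
    linarith [hρ0 k]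
  have hanti : Antitone ρ := antitone_nat_of_succ_le fun k => by
    linarith [hdiff k, mul_nonneg (hτ0 k) (hρ0 k)]
  have hbdd : BddBelow (Set.range ρ) := ⟨0, Set.forall_mem_range.2 hρ0⟩
  have hlim := tendsto_atTop_ciInf hanti hbdd
  refine ⟨hs, ?_⟩
  rcases (le_ciInf hρ0).eq_or_lt with h | h
  · rwa [← h] at hlim
  · refine absurd (Summable.of_nonneg_of_le hτ0 (fun k => ?_) (hs.mul_right (⨅ i, ρ i)⁻¹)) hτ
    rw [← div_eq_mul_inv, le_div_iff₀ h]
    exact mul_le_mul_of_nonneg_left (ciInf_le hbdd k) (hτ0 k)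

lemma eventually_abs_sum_shift_le {m q : ℕ → ℝ} (K : ℕ)
    (h : ∀ ε > 0, ∃ B, ∀ᶠ k in atTop, |∑ j ∈ Finset.range k, m j|
      ≤ ε * ∑ j ∈ Finset.range k, q j + B) :
    ∀ ε > 0, ∃ B, ∀ᶠ k in atTop, |∑ j ∈ Finset.range k, m (j + K)|
      ≤ ε * ∑ j ∈ Finset.range k, q (j + K) + B := by
  intro ε hε
  obtain ⟨B, hB⟩ := h ε hε
  refine ⟨B + ε * ∑ j ∈ Finset.range K, q j + |∑ j ∈ Finset.range K, m j|, ?_⟩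
  filter_upwards [(tendsto_add_atTop_nat K).eventually hB] with k hk
  have hsplit : ∀ g : ℕ → ℝ, ∑ j ∈ Finset.range (k + K), g j
      = ∑ j ∈ Finset.range K, g j + ∑ j ∈ Finset.range k, g (j + K) := fun g => by
    rw [add_comm k K, Finset.sum_range_add]
    simp_rw [add_comm K]
  rw [hsplit, hsplit] at hk
  have h1 := abs_sub_abs_le_abs_sub (∑ j ∈ Finset.range k, m (j + K))
    (-∑ j ∈ Finset.range K, m j)
  rw [abs_neg, sub_neg_eq_add, add_comm (∑ j ∈ Finset.range k, m (j + K))] at h1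
  linarith

lemma _root_.MapClusterPt.of_tendsto_sub {ι F : Type*} [SeminormedAddCommGroup F] {l : Filter ι}
    {u v : ι → F} {q : F} (hu : MapClusterPt q l u)
    (h : Tendsto (fun i => u i - v i) l (𝓝 0)) : MapClusterPt q l v := by
  obtain ⟨U, hU, hUu⟩ := mapClusterPt_iff_ultrafilter.1 hu
  refine mapClusterPt_iff_ultrafilter.2 ⟨U, hU, ?_⟩
  simpa using hUu.sub (h.mono_left hU)

section Companion

variable {n : ℕ} {Ω : Type*} [MeasurableSpace Ω] {X : Set (EuclideanSpace ℝ (Fin n))} {a β : ℝ}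
  {τ : ℕ → Ω → ℝ} {s x y z : ℕ → Ω → EuclideanSpace ℝ (Fin n)}

lemma IsASASequence.companion_mem (hS : IsASASequence X a β τ s x y z) (hX : Convex ℝ X) (k : ℕ)
    (ω : Ω) : companion τ x y k ω ∈ X := by
  induction k with
  | zero => exact hS.x_zero_mem ω
  | succ k ih =>
    exact hX.add_smul_sub_mem ih (hS.y_mem k ω)
      ⟨le_min (hS.τ_pos k ω).le zero_le_one, min_le_right _ _⟩

lemma IsASASequence.isSubproblemSol (hS : IsASASequence X a β τ s x y z) (hX : Convex ℝ X) (k : ℕ)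
    (ω : Ω) : IsSubproblemSol X β (x k ω) (z k ω) (y k ω) :=
  IsMinOn.isSubproblemSol hX (hS.y_mem k ω) (hS.y_min k ω)

lemma IsASASequence.isSubproblemSol_companion (hS : IsASASequence X a β τ s x y z)
    (hX : Convex ℝ X) (k : ℕ) (ω : Ω) :
    IsSubproblemSol X β (companion τ x y k ω) (companionAvg β τ x y z k ω) (y k ω) := by
  have h := hS.isSubproblemSol hX k ω
  refine ⟨h.1, fun y' hy' => ?_⟩
  have e : companionAvg β τ x y z k ω + β • (y k ω - companion τ x y k ω)
      = z k ω + β • (y k ω - x k ω) := by rw [companionAvg]; module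
  rw [e]
  exact h.2 y' hy'

/-- Convergence of one sample path, on the event where the noise series behave. Once the stepsizes
are at most `1`, the companion sequences form a path of the method that stays in `X`, with an oracle
bias proportional to `x - companion`, and this difference contracts by `1 - τ k` at each step. -/
lemma IsASASequence.mem_normalCone_of_mapClusterPt (hS : IsASASequence X a β τ s x y z)
    (hXconv : Convex ℝ X) (hXclosed : IsClosed X)
    {f : EuclideanSpace ℝ (Fin n) → ℝ} (hf : Differentiable ℝ f) {L : ℝ≥0}
    (hL : LipschitzWith L (gradient f)) (ha : 0 < a) (hβ : 0 < β) (ω : Ω)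
    (hτ : ¬ Summable fun k => τ k ω) (hτ2 : Summable fun k => τ k ω ^ 2)
    (he : ∃ c, Tendsto (fun k => ∑ j ∈ Finset.range k,
      τ j ω • (s (j + 1) ω - gradient f (x j ω))) atTop (𝓝 c))
    (he2 : Summable fun k => τ k ω ^ 2 * ‖s (k + 1) ω - gradient f (x k ω)‖ ^ 2)
    (hlaw : ∀ ε > 0, ∃ B, ∀ᶠ k in atTop, |∑ j ∈ Finset.range k,
        ⟪τ j ω • noiseCoeff f a β L (companion τ x y j ω) (companionAvg β τ x y z j ω) (y j ω),
          s (j + 1) ω - gradient f (x j ω)⟫_ℝ|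
      ≤ ε * ∑ j ∈ Finset.range k, ‖τ j ω • noiseCoeff f a β L (companion τ x y j ω)
          (companionAvg β τ x y z j ω) (y j ω)‖ ^ 2 + B)
    {xs zs : EuclideanSpace ℝ (Fin n)}
    (hcl : MapClusterPt (xs, zs) atTop fun k => (x k ω, z k ω)) :
    zs = gradient f xs ∧ -zs ∈ normalCone X xs := by
  have hτ0 : ∀ k, 0 ≤ τ k ω := fun k => (hS.τ_pos k ω).le
  have hτlim : Tendsto (fun k => τ k ω) atTop (𝓝 0) := by
    have := hτ2.tendsto_atTop_zero.sqrt
    simpa [Real.sqrt_sq (hτ0 _)] using this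
  obtain ⟨K, hK⟩ := eventually_atTop.1 (hτlim.eventually_le_const zero_lt_one)
  have hτ1 : ∀ k, τ (k + K) ω ≤ 1 := fun k => hK _ (Nat.le_add_left K k)
  have hτK : ¬ Summable fun k => τ (k + K) ω := fun h => hτ ((summable_nat_add_iff K).1 h)
  set xt : ℕ → EuclideanSpace ℝ (Fin n) := fun k => companion τ x y k ω with hxt
  set zt : ℕ → EuclideanSpace ℝ (Fin n) := fun k => companionAvg β τ x y z k ω with hzt
  have hzt' : ∀ k, zt k = z k ω - β • (x k ω - xt k) := fun k => rfl
  have hxts : ∀ k, xt (k + K + 1) = xt (k + K) + τ (k + K) ω • (y (k + K) ω - xt (k + K)) :=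
    fun k => by simp only [hxt, companion, min_eq_left (hτ1 k)]
  have hδs : ∀ k, x (k + K + 1) ω - xt (k + K + 1)
      = (1 - τ (k + K) ω) • (x (k + K) ω - xt (k + K)) := fun k => by
    rw [hxts, hS.x_succ]; module
  obtain ⟨hδsum, hδlim⟩ := summable_mul_and_tendsto_zero_of_contraction
    (τ := fun k => τ (k + K) ω) (ρ := fun k => ‖x (k + K) ω - xt (k + K)‖) (fun k => hτ0 _) hτK
    (fun k => norm_nonneg _) (fun k => by
      have h := hδs k
      rw [show k + 1 + K = k + K + 1 by ring, h, norm_smul,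
        Real.norm_of_nonneg (by linarith [hτ1 k])])
  set b : ℕ → EuclideanSpace ℝ (Fin n) := fun k => gradient f (x k ω) - gradient f (xt k)
    + (β * (1 - a) / a) • (x k ω - xt k) with hb
  set M : ℝ := L + |β * (1 - a) / a| with hM
  have hM0 : 0 ≤ M := by positivity
  have hbn : ∀ k, ‖b k‖ ≤ M * ‖x k ω - xt k‖ := fun k => by
    refine (norm_add_le _ _).trans ?_
    rw [norm_smul, Real.norm_eq_abs, hM, add_mul]
    gcongr
    exact hL.norm_sub_le _ _
  have hbsum : Summable fun k => τ (k + K) ω * ‖b (k + K)‖ :=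
    Summable.of_nonneg_of_le (fun k => mul_nonneg (hτ0 _) (norm_nonneg _))
      (fun k => by
        have := mul_le_mul_of_nonneg_left (hbn (k + K)) (hτ0 (k + K))
        linarith) (hδsum.mul_left M)
  have hblim : Tendsto (fun k => ‖b (k + K)‖) atTop (𝓝 0) :=
    squeeze_zero (fun k => norm_nonneg _) (fun k => hbn (k + K)) (by simpa using hδlim.const_mul M)
  have hb2sum : Summable fun k => τ (k + K) ω * ‖b (k + K)‖ ^ 2 := by
    refine summable_of_isBigO_nat hbsum (Asymptotics.IsBigO.of_bound 1 ?_)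
    filter_upwards [hblim.eventually_le_const zero_lt_one] with k hk
    have h1 := hτ0 (k + K)
    have h2 := norm_nonneg (b (k + K))
    rw [Real.norm_of_nonneg (by positivity), Real.norm_of_nonneg (by positivity), one_mul]
    exact mul_le_mul_of_nonneg_left (by nlinarith) h1
  have hclK : MapClusterPt (xs, zs) atTop fun k => (x (k + K) ω, z (k + K) ω) := by
    have : map (fun k => (x (k + K) ω, z (k + K) ω)) atTop
        = map (fun k => (x k ω, z k ω)) atTop := by
      conv_rhs => rw [← map_add_atTop_eq_nat K, Filter.map_map]
      rfl
    rwa [MapClusterPt, this]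
  have hclt : MapClusterPt (xs, zs) atTop fun k => (xt (k + K), zt (k + K)) := by
    refine hclK.of_tendsto_sub ?_
    have h1 : Tendsto (fun k => x (k + K) ω - xt (k + K)) atTop (𝓝 0) :=
      tendsto_zero_iff_norm_tendsto_zero.2 hδlim
    have h2 := h1.prodMk_nhds (h1.const_smul β)
    rw [smul_zero, Prod.mk_zero_zero] at h2
    refine Tendsto.congr (fun k => ?_) h2
    simp [hzt']
  refine ASA.mem_normalCone_of_mapClusterPt hXconv hXclosed hf hL ha hβ
    (τ := fun k => τ (k + K) ω) (x := fun k => xt (k + K)) (z := fun k => zt (k + K))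
    (y := fun k => y (k + K) ω) (b := fun k => b (k + K))
    (e := fun k => s (k + K + 1) ω - gradient f (x (k + K) ω))
    (fun k => hτ0 _) hτ1 ((tendsto_add_atTop_iff_nat K).2 hτlim) hτK
    (fun k => hS.companion_mem hXconv _ ω) (fun k => hS.isSubproblemSol_companion hXconv _ ω)
    (fun k => ?_) (fun k => ?_) hbsum hb2sum ?_ ((summable_nat_add_iff K).2 he2) ?_ hclt
  · rw [show k + 1 + K = k + K + 1 by ring]
    exact hxts k
  · rw [show k + 1 + K = k + K + 1 by ring, hzt', hzt', hδs, hS.z_succ, hb]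
    have e1 : (a * τ (k + K) ω) • (β * (1 - a) / a) • (x (k + K) ω - xt (k + K))
        = (τ (k + K) ω * (β * (1 - a))) • (x (k + K) ω - xt (k + K)) := by
      rw [smul_smul]; congr 1; field_simp
    simp only [smul_sub, smul_add] at e1 ⊢
    rw [e1]
    module
  · obtain ⟨c, hc⟩ := he
    refine ⟨c - ∑ j ∈ Finset.range K, τ j ω • (s (j + 1) ω - gradient f (x j ω)), ?_⟩
    refine (((tendsto_add_atTop_iff_nat K).2 hc).sub_const _).congr fun k => ?_
    rw [add_comm k K, Finset.sum_range_add, add_sub_cancel_left]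
    simp_rw [add_comm K]
  · have := eventually_abs_sum_shift_le K hlaw
    simpa only [real_inner_smul_left, norm_smul, mul_pow, Real.norm_eq_abs, sq_abs] using this

end Companion

/-! ### Almost sure behaviour -/

section Probability

variable {n : ℕ} {Ω : Type*} {X : Set (EuclideanSpace ℝ (Fin n))}
  {a β : ℝ} {τ : ℕ → Ω → ℝ} {s x y z : ℕ → Ω → EuclideanSpace ℝ (Fin n)}

/-- The filtration of the histories. -/
def historyFiltration {mΩ : MeasurableSpace Ω} (hx : ∀ k, Measurable (x k))
    (hz : ∀ k, Measurable (z k)) : Filtration ℕ mΩ where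
  seq := history x z
  mono' _ _ hij := biSup_mono fun _ hk => le_trans hk hij
  le' _ := iSup₂_le fun k _ => sup_le (hx k).comap_le (hz k).comap_le

lemma measurable_history_left {k : ℕ} : Measurable[history x z k] (x k) :=
  Measurable.of_comap_le (le_trans le_sup_left
    (le_iSup₂_of_le (f := fun i (_ : i ∈ Set.Iic k) => MeasurableSpace.comap (x i) inferInstance
      ⊔ MeasurableSpace.comap (z i) inferInstance) k (Set.mem_Iic.2 le_rfl) le_rfl))

lemma measurable_history_right {k : ℕ} : Measurable[history x z k] (z k) :=
  Measurable.of_comap_le (le_trans le_sup_right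
    (le_iSup₂_of_le (f := fun i (_ : i ∈ Set.Iic k) => MeasurableSpace.comap (x i) inferInstance
      ⊔ MeasurableSpace.comap (z i) inferInstance) k (Set.mem_Iic.2 le_rfl) le_rfl))

lemma IsASASequence.measurable_y_history [MeasurableSpace Ω]
    (hS : IsASASequence X a β τ s x y z) (hX : Convex ℝ X) (hXc : IsClosed X)
    (hβ : 0 < β) (k : ℕ) : Measurable[history x z k] (y k) := by
  rcases isEmpty_or_nonempty Ω with h | ⟨⟨ω₀⟩⟩
  · exact fun t _ => by
      rw [Set.eq_empty_of_isEmpty (y k ⁻¹' t)]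
      exact @MeasurableSet.empty _ (history x z k)
  obtain ⟨P, hPc, hP⟩ := exists_continuous_isSubproblemSol hX hXc ⟨_, hS.x_zero_mem ω₀⟩ hβ
  have : y k = fun ω => P (x k ω, z k ω) :=
    funext fun ω => (hS.isSubproblemSol hX k ω).eq hβ (hP (x k ω, z k ω))
  rw [this]
  exact hPc.measurable.comp (Measurable.prodMk measurable_history_left measurable_history_right)

lemma IsASASequence.measurable_companion [MeasurableSpace Ω]
    (hS : IsASASequence X a β τ s x y z) (hX : Convex ℝ X) (hXc : IsClosed X)
    (hβ : 0 < β) (k : ℕ) :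
    Measurable[history x z k] (companion τ x y k) := by
  induction k with
  | zero =>
    have h : Measurable[history x z 0] (x 0) := measurable_history_left
    exact h
  | succ k ih =>
    have hle : history x z k ≤ history x z (k + 1) :=
      (historyFiltration hS.measurable_x hS.measurable_z).mono (Nat.le_succ k)
    have hτ : Measurable[history x z k] fun ω => min (τ k ω) 1 :=
      (hS.measurable_τ k).min measurable_const
    have hd : Measurable[history x z k] fun ω => y k ω - companion τ x y k ω :=
      (hS.measurable_y_history hX hXc hβ k).sub ih
    have h : Measurable[history x z k] fun ω =>
        companion τ x y k ω + min (τ k ω) 1 • (y k ω - companion τ x y k ω) :=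
      ih.add (hτ.smul hd)
    exact h.mono hle le_rfl

lemma IsASASequence.measurable_companionAvg [MeasurableSpace Ω]
    (hS : IsASASequence X a β τ s x y z)
    (hX : Convex ℝ X) (hXc : IsClosed X) (hβ : 0 < β) (k : ℕ) :
    Measurable[history x z k] (companionAvg β τ x y z k) :=
  measurable_history_right.sub ((measurable_history_left.sub
    (hS.measurable_companion hX hXc hβ k)).const_smul β)

/-- The oracle error is a martingale difference noise. It is adapted because `s (k + 1)` can be
recovered from `z k`, `z (k + 1)` and `τ k`. -/
lemma IsASASequence.isNoise {mΩ : MeasurableSpace Ω} (hS : IsASASequence X a β τ s x y z)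
    {μ : Measure Ω} [IsProbabilityMeasure μ] {f : EuclideanSpace ℝ (Fin n) → ℝ} {σ : ℝ} {L : ℝ≥0}
    (hL : LipschitzWith L (gradient f)) (hO : IsOracle μ f σ s x z) (ha : 0 < a) :
    IsNoise (historyFiltration hS.measurable_x hS.measurable_z) μ σ
      (fun k ω => s (k + 1) ω - gradient f (x k ω)) where
  stronglyMeasurable k := by
    have hle : history x z k ≤ history x z (k + 1) :=
      (historyFiltration hS.measurable_x hS.measurable_z).mono (Nat.le_succ k)
    have hτ : Measurable[history x z (k + 1)] (τ k) := (hS.measurable_τ k).mono hle le_rfl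
    have hx : Measurable[history x z (k + 1)] (x k) := measurable_history_left.mono hle le_rfl
    have hz : Measurable[history x z (k + 1)] (z k) := measurable_history_right.mono hle le_rfl
    have hrec : (fun ω => s (k + 1) ω - gradient f (x k ω)) = fun ω =>
        (a * τ k ω)⁻¹ • (z (k + 1) ω - (1 - a * τ k ω) • z k ω) - gradient f (x k ω) := by
      funext ω
      have h := mul_pos ha (hS.τ_pos k ω)
      rw [hS.z_succ, add_sub_cancel_left, inv_smul_smul₀ h.ne']
    rw [hrec]
    refine Measurable.stronglyMeasurable ?_
    exact ((hτ.const_mul a).inv.smul (measurable_history_right.sub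
      ((measurable_const.sub (hτ.const_mul a)).smul hz))).sub (hL.continuous.measurable.comp hx)
  integrable_sq := hO.integrable_sq
  condExp_eq_zero k := by
    have hle : history x z k ≤ mΩ :=
      (historyFiltration hS.measurable_x hS.measurable_z).le k
    have hg : StronglyMeasurable[history x z k] fun ω => gradient f (x k ω) :=
      (hL.continuous.measurable.comp measurable_history_left).stronglyMeasurable
    have hgi : Integrable (fun ω => gradient f (x k ω)) μ :=
      integrable_condExp.congr (hO.unbiased k)
    have h1 := condExp_sub (hO.integrable k) hgi (history x z k)
    rw [condExp_of_stronglyMeasurable hle hg hgi] at h1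
    refine h1.trans ?_
    filter_upwards [hO.unbiased k] with ω hω
    simp [hω]
  condExp_sq_le := hO.variance_le

end Probability

end ASA

theorem theorem4p3 {n : ℕ}
    (X : Set (EuclideanSpace ℝ (Fin n))) (hXconv : Convex ℝ X) (hXclosed : IsClosed X)
    (f : EuclideanSpace ℝ (Fin n) → ℝ) (hf : Differentiable ℝ f)
    (L : ℝ≥0) (hL : LipschitzWith L (gradient f))
    (β : ℝ) (hβ : 0 < β) (σ : ℝ) :
    ∃ abar : ℝ, 0 < abar ∧ ∀ a : ℝ, 0 < a → a < abar →
      ∀ (Ω : Type*) [MeasurableSpace Ω] (μ : Measure Ω) [IsProbabilityMeasure μ]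
        (τ : ℕ → Ω → ℝ) (s x y z : ℕ → Ω → EuclideanSpace ℝ (Fin n)),
        ASA.IsASASequence X a β τ s x y z →
        ASA.IsOracle μ f σ s x z →
        (∀ᵐ ω ∂μ, Tendsto (fun N : ℕ => ∑ k ∈ Finset.Icc 1 N, τ k ω) atTop atTop) →
        ∫⁻ ω, ∑' k : ℕ, ENNReal.ofReal (τ (k + 1) ω ^ 2) ∂μ < ∞ →
        ∀ᵐ ω ∂μ, ∀ xs zs : EuclideanSpace ℝ (Fin n),
          MapClusterPt (xs, zs) atTop (fun k : ℕ => (x k ω, z k ω)) →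
            zs = gradient f xs ∧ -zs ∈ ASA.normalCone X xs := by
  -- every `a > 0` works, so any positive threshold will do
  refine ⟨1, one_pos, fun a ha _ Ω _ μ _ τ s x y z hS hO hτ hτ2 => ?_⟩
  have he := hS.isNoise hL hO ha
  have hτm : ∀ k, StronglyMeasurable[ASA.history x z k] (τ k) := fun k =>
    (hS.measurable_τ k).stronglyMeasurable
  have hτM : ∀ k, Measurable (τ k) := fun k => (hS.measurable_τ k).mono
    ((ASA.historyFiltration hS.measurable_x hS.measurable_z).le k) le_rfl
  have hτabs : ∀ k ω, |τ k ω| ≤ 1 / a := fun k ω => by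
    rw [abs_of_pos (hS.τ_pos k ω)]; exact hS.τ_le k ω
  have hτsq : ∀ k ω, τ k ω ^ 2 ≤ (1 / a) ^ 2 := fun k ω =>
    pow_le_pow_left₀ (hS.τ_pos k ω).le (hS.τ_le k ω) 2
  have hτ2i : ∀ k, Integrable (fun ω => τ k ω ^ 2) μ := fun k =>
    Integrable.of_bound ((hτM k).pow_const 2).aestronglyMeasurable ((1 / a) ^ 2)
      (Eventually.of_forall fun ω => by
        rw [Real.norm_of_nonneg (sq_nonneg _)]; exact hτsq k ω)
  have hsum : Summable fun k => ∫ ω, τ k ω ^ 2 ∂μ := by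
    rw [← summable_nat_add_iff 1]
    rw [lintegral_tsum fun k => ((hτM _).pow_const 2).ennreal_ofReal.aemeasurable] at hτ2
    refine (ENNReal.summable_toReal hτ2.ne).congr fun k => ?_
    rw [integral_eq_lintegral_of_nonneg_ae (Eventually.of_forall fun ω => sq_nonneg _)
      (hτ2i _).1]
  have hae2 : ∀ᵐ ω ∂μ, Summable fun k => τ k ω ^ 2 := by
    filter_upwards [ae_lt_top' (AEMeasurable.tsum
      fun k => ((hτM (k + 1)).pow_const 2).ennreal_ofReal.aemeasurable) hτ2.ne] with ω hω
    rw [← summable_nat_add_iff 1]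
    exact (ENNReal.summable_toReal hω.ne).congr fun k => ENNReal.toReal_ofReal (sq_nonneg _)
  have hvm : ∀ k, StronglyMeasurable[ASA.history x z k] fun ω => τ k ω •
      ASA.noiseCoeff f a β L (ASA.companion τ x y k ω) (ASA.companionAvg β τ x y z k ω)
        (y k ω) := fun k => by
    have h1 := hS.measurable_companion hXconv hXclosed hβ k
    have h2 := hS.measurable_companionAvg hXconv hXclosed hβ k
    have h3 := hS.measurable_y_history hXconv hXclosed hβ k
    have h4 : Measurable[ASA.history x z k] fun ω => gradient f (ASA.companion τ x y k ω) :=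
      hL.continuous.measurable.comp h1
    have h5 : Measurable[ASA.history x z k] fun ω => a • (y k ω - ASA.companion τ x y k ω) :=
      (h3.sub h1).const_smul a
    have h6 : Measurable[ASA.history x z k] fun ω => (2 * ASA.meritWeight a β L * a) •
        (gradient f (ASA.companion τ x y k ω) - ASA.companionAvg β τ x y z k ω) :=
      (h4.sub h2).const_smul (2 * ASA.meritWeight a β L * a)
    have h7 : Measurable[ASA.history x z k] fun ω =>
        ASA.noiseCoeff f a β L (ASA.companion τ x y k ω) (ASA.companionAvg β τ x y z k ω)
          (y k ω) := h5.add h6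
    exact ((hS.measurable_τ k).smul h7).stronglyMeasurable
  filter_upwards [hτ, hae2, he.ae_exists_tendsto_sum_smul hτm hτabs hsum,
    he.summable_weight_mul_sq (fun k => (hτm k).pow 2) (fun k ω => sq_nonneg _) hτsq hsum,
    he.ae_abs_sum_inner_le hvm] with ω h1 h2 h3 h4 h5 xs zs hcl
  refine hS.mem_normalCone_of_mapClusterPt hXconv hXclosed hf hL ha hβ ω (fun hs => ?_) h2 h3 h4
    h5 hcl
  obtain ⟨N, hN⟩ := (h1.eventually_gt_atTop (∑' k, τ k ω)).exists
  exact absurd (hs.sum_le_tsum _ fun k _ => (hS.τ_pos k ω).le) (not_le.2 hN)
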